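/- Let $\mathcal C\subset\mathbb R^2$ be a finite set and let $\operatorname{conv}(\mathcal C)$ be its convex hull. A point $P\in\mathcal C$ is extremal if $\operatorname{conv}(\mathcal C\setminus\{P\})\ne\operatorname{conv}(\mathcal C)$. A triangulation of $\mathcal C$ is a finite set of non-degenerate Euclidean triangles with vertices in $\mathcal C$ whose union is $\operatorname{conv}(\mathcal C)$, and such that any two distinct triangles are disjoint or intersect exactly in a common vertex or exactly in a common edge; it uses the points of $\mathcal C$ that are vertices of at least one of its triangles. Let $\tau_k(\mathcal C)$ be the number of triangulations of $\mathcal C$ that use exactly $k$ points. The triangulation polynomial of $\mathcal C$ is $\sum_k\tau_k(\mathcal C)\,s^k\in\mathbb Z[s]$. For natural numbers $l\ge 3$ and $a_1,\dots,a_l\ge 1$, let $P(a_1,\dots,a_l)$ denote an arbitrary weakly convex polygon with $l$ edges of successive weights $a_1,\dots,a_l$. That is, it is a finite set $\mathcal C\subset\mathbb R^2$ contained in the boundary of $\operatorname{conv}(\mathcal C)$, with exactly $l$ extremal points, which can be listed in counterclockwise order as $v_1,\dots,v_l$ in such a way that, for every $i$, the segment $[v_i,v_{i+1}]$ (with $v_{l+1}=v_1$)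 contains exactly $a_i+1$ points of $\mathcal C$. For $m\ge 1$ define the maximal and the complete edge polynomials by $$p_m(t)=\sum_{k=0}^{\lfloor m/2\rfloor}(-1)^k\binom{m-k}{k}t^{m-k}\in\mathbb Z[t],\qquad \overline p_m(t)=\sum_{k=1}^m\binom{m-1}{k-1}p_k(t)\,s^k\in\mathbb Z[s,t].$$ Let $G_C(t)=\sum_{k\ge 0}C_kt^k$, where $C_k=\frac1{k+1}\binom{2k}{k}$ is the $k$-th Catalan number. For a polynomial $p(t)=\sum_{k\ge 2}\alpha_kt^k$ with coefficients $\alpha_k\in\mathbb Z[s]$, put $\langle p(t),t^2G_C(t)\rangle_t=\sum_{k\ge2}\alpha_kC_{k-2}$. Theorem. For all natural numbers $l\ge 3$ and $a_1,\dots,a_l\ge 1$, the triangulation polynomial of every weakly convex polygon $P(a_1,\dots,a_l)$ is $$\sum_k\tau_k(a_1,\dots,a_l)\,s^k=\Big\langle\prod_{i=1}^l\overline p_{a_i}(t),\,t^2G_C(t)\Big\rangle_t,$$ where $\tau_k(a_1,\dots,a_l)$ is the number of triangulations of $P(a_1,\dots,a_l)$ that use exactly $k$ points. -/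

import Mathlib

open Polynomial

namespace WeaklyConvex

/-- The Euclidean plane, with its standard orientation. -/
abbrev Plane : Type := EuclideanSpace ℝ (Fin 2)

/-- Twice the signed area of the triangle `A B D`; it is positive iff `A`, `B`, `D` is a
counterclockwise triple of non-collinear points. -/
def orient (A B D : Plane) : ℝ :=
  (B 0 - A 0) * (D 1 - A 1) - (B 1 - A 1) * (D 0 - A 0)

/-- The extremal points of a configuration: the points `Q` of `S` with
`conv (S \ {Q}) ≠ conv S`. -/
def extr (S : Finset Plane) : Set Plane :=
  {Q | Q ∈ S ∧ convexHull ℝ ((S : Set Plane) \ {Q}) ≠ convexHull ℝ (S : Set Plane)}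

/-- `T` is a triangulation of the configuration `S`. A triangle is recorded by the set `Δ` of its
three vertices; as a region it is `convexHull ℝ Δ`. Two different three-element sets share at most
two points, so `face_to_face` says that two different triangles are disjoint or meet
exactly in a common vertex or exactly in a common edge. Points of `S` need not all be used. -/
structure IsTriangulation (S : Finset Plane) (T : Finset (Finset Plane)) : Prop where
  vertices_subset : ∀ Δ ∈ T, Δ ⊆ S
  card_eq_three : ∀ Δ ∈ T, Δ.card = 3
  nondegenerate : ∀ Δ ∈ T, AffineIndependent ℝ (fun Q : Δ => (Q : Plane))
  covers : convexHull ℝ (S : Set Plane) = ⋃ Δ ∈ T, convexHull ℝ (Δ : Set Plane)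
  face_to_face : ∀ Δ ∈ T, ∀ Δ' ∈ T, Δ ≠ Δ' →
    convexHull ℝ (Δ : Set Plane) ∩ convexHull ℝ (Δ' : Set Plane) =
      convexHull ℝ ((Δ : Set Plane) ∩ (Δ' : Set Plane))

open Classical in
/-- The finite set of all triangulations of a configuration. -/
noncomputable def triangulations (S : Finset Plane) : Finset (Finset (Finset Plane)) :=
  S.powerset.powerset.filter (fun T => IsTriangulation S T)

theorem mem_triangulations (S : Finset Plane) (T : Finset (Finset Plane)) :
    T ∈ triangulations S ↔ IsTriangulation S T := by
  classical
  simp only [triangulations, Finset.mem_filter, Finset.mem_powerset, and_iff_right_iff_imp]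
  intro h Δ hΔ
  exact Finset.mem_powerset.2 (h.vertices_subset Δ hΔ)

open Classical in
/-- The points used by `T`: all vertices of triangles of `T`. -/
noncomputable def usedPoints (T : Finset (Finset Plane)) : Finset Plane :=
  T.biUnion (fun Δ => Δ)

/-- `τ_k(S)`: the number of triangulations of `S` that use exactly `k` points. -/
noncomputable def tau (S : Finset Plane) (k : ℕ) : ℕ :=
  ((triangulations S).filter (fun T => (usedPoints T).card = k)).card

/-- The triangulation polynomial `∑ₖ τ_k(S) sᵏ`; no triangulation of `S` uses more
than `#S` points. -/
noncomputable def triangulationPolynomial (S : Finset Plane) : ℤ[X] :=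
  ∑ k ∈ Finset.range (S.card + 1), (tau S k : ℤ[X]) * X ^ k

/-- `S` is a weakly convex polygon `P(a₁, …, a_l)`: `S` lies on the boundary of its convex
hull, and the extremal points of `S` can be listed as `v₁, …, v_l` in counterclockwise order so
that the edge from `vᵢ` to its cyclic successor contains exactly `aᵢ + 1` points of `S`. -/
def IsWeaklyConvexPolygon {l : ℕ} (a : Fin l → ℕ) (S : Finset Plane) : Prop :=
  (S : Set Plane) ⊆ frontier (convexHull ℝ (S : Set Plane)) ∧
  ∃ v : Fin l → Plane,
    Set.range v = extr S ∧
    (∀ i j k : Fin l, i < j → j < k → 0 < orient (v i) (v j) (v k)) ∧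
    ∀ i : Fin l, ((S : Set Plane) ∩ segment ℝ (v i) (v (finRotate l i))).ncard = a i + 1

/-- The maximal edge polynomial
`p_m(t) = ∑_{k=0}^{⌊m/2⌋} (-1)ᵏ (m-k choose k) t^{m-k}`. -/
noncomputable def maxEdgePolynomial (m : ℕ) : ℤ[X] :=
  ∑ k ∈ Finset.range (m / 2 + 1), (-1) ^ k * ((m - k).choose k : ℤ[X]) * X ^ (m - k)

/-- The complete edge polynomial `∑_{k=1}^m (m-1 choose k-1) p_k(t) sᵏ` in `ℤ[s][t]`: the outer
variable is `t`, and the coefficients are polynomials in `s`. -/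
noncomputable def completeEdgePolynomial (m : ℕ) : ℤ[X][X] :=
  ∑ k ∈ Finset.Icc 1 m,
    ((m - 1).choose (k - 1) : ℤ[X][X]) *
      (maxEdgePolynomial k).map (Polynomial.C : ℤ →+* ℤ[X]) * Polynomial.C (X ^ k)

/-- The generating series `G_C(t) = ∑ₖ C_k tᵏ` of the Catalan numbers, over a commutative
ring `R`. -/
noncomputable def catalanGenerating (R : Type*) [CommRing R] : PowerSeries R :=
  PowerSeries.catalanSeries.map (Nat.castRingHom R)

/-- The duality pairing `⟨∑ αₖ tᵏ, ∑ gₖ tᵏ⟩_t = ∑ αₖ gₖ` of a polynomial with a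
formal power series. -/
noncomputable def pairing {R : Type*} [CommRing R] (p : R[X]) (g : PowerSeries R) : R :=
  p.sum (fun k α => α * PowerSeries.coeff k g)

end WeaklyConvex

/-!
The proof has a geometric half, which shows that triangulations using a prescribed set of points
satisfy a Catalan-type recursion, and an algebraic half, which solves this recursion.

A triangulation of `S` that uses exactly the set `U` is the same as a triangulation of `U` that uses
every point of `U` (`isTriangulation_iff_of_usedPoints`), and `U` contains the extremal points
(`IsTriangulation.extr_subset`). Such a full triangulation is counted by the maximal edge
polynomials (`IsStrictPolygon.card_full`). Summing `s ^ #U` over all `U` multiplies out to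
the complete edge polynomials, because `U` is an independent choice of a subset of the interior of
every side (`sum_param_subsets`, `completeEdgePolynomial_card`).

Full triangulations are cut along the triangle on a base edge. A weakly convex chain
`w i, …, w j` is closed by the base edge from `w j` to `w i`; a full triangulation has a
unique triangle `w i, w k, w j` on it, and all the other triangles lie in one of the chains
`w i, …, w k` and `w k, …, w j`. Conversely, full triangulations of the two chains can be
glued to any non-degenerate base triangle. This gives
`IsConvexChain.card_fullTriangulations`. The geometric input is that two faces of a triangulation
meet in the hull of their common vertices (`IsTriangulation.convexHull_inter`) while the diagonals of
a weakly convex quadrilateral meet (`exists_mem_segment_inter`).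

On the algebraic side, `p_m` satisfies `p_{m+2} = t (p_{m+1} - p_m)`, so a product of edge polynomials
along a chain is a continuant (`continuant`, `continuant_add`). Pairing the continuant of a chain,
times `t` for the base edge, with `t² G_C(t)` gives numbers that satisfy the same recursion
(`chainNumber_succ`). The polygon itself is cut open at the last edge of its last side, of
weight `b`. The apices on that side are forbidden, and removing their contribution replaces
`t p_{b-1}` by `t (p_{b-1} - p_{b-2}) = p_b`, with `p_{-1} = 0`
(`IsConvexChain.card_fullTriangulations_closed`).
-/

namespace WeaklyConvex

/-! ### Oriented areas and convex hulls in the plane -/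

theorem plane_ext {p q : Plane} (h0 : p 0 = q 0) (h1 : p 1 = q 1) : p = q := by
  ext i
  fin_cases i
  · exact h0
  · exact h1

theorem orient_rotate (a b c : Plane) : orient b c a = orient a b c := by
  simp only [orient]; ring

theorem orient_rotate' (a b c : Plane) : orient a b c = orient b c a := by
  simp only [orient]; ring

theorem orient_swap (a b c : Plane) : orient a c b = -orient a b c := by
  simp only [orient]; ring

@[simp] theorem orient_self_left (a b : Plane) : orient a a b = 0 := by
  simp only [orient]; ring

@[simp] theorem orient_self_right (a b : Plane) : orient a b b = 0 := by
  simp only [orient]; ring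

@[simp] theorem orient_self_outer (a b : Plane) : orient a b a = 0 := by
  simp only [orient]; ring

theorem orient_combo (a b x y : Plane) {s t : ℝ} (h : s + t = 1) :
    orient a b (s • x + t • y) = s * orient a b x + t * orient a b y := by
  obtain rfl : s = 1 - t := by linarith
  simp only [orient, PiLp.add_apply, PiLp.smul_apply, smul_eq_mul]
  ring

/-- The areas cut off by a quadrilateral's two diagonals have the same sum. -/
theorem orient_add_orient (a b c d : Plane) :
    orient b c d + orient a b d = orient a c d + orient a b c := by
  simp only [orient]; ring

/-- The affine dependence between four points of the plane, with oriented areas as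
coefficients. -/
theorem orient_smul_add_orient_smul (a b c d : Plane) :
    orient b c d • a + orient a b d • c = orient a c d • b + orient a b c • d := by
  apply plane_ext <;>
  · simp only [orient, PiLp.add_apply, PiLp.smul_apply, smul_eq_mul]
    ring

/-- In a weakly convex quadrilateral `a b c d` the two diagonals meet. -/
theorem exists_mem_segment_inter {a b c d : Plane} (h1 : 0 ≤ orient b c d)
    (h2 : 0 ≤ orient a b d) (h3 : 0 ≤ orient a c d) (h4 : 0 ≤ orient a b c)
    (hD : 0 < orient b c d + orient a b d) :
    ∃ z, z ∈ segment ℝ a c ∧ z ∈ segment ℝ b d := by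
  set D := orient b c d + orient a b d with hDdef
  have hD' : D = orient a c d + orient a b c := orient_add_orient a b c d
  have key := orient_smul_add_orient_smul a b c d
  refine ⟨(orient b c d / D) • a + (orient a b d / D) • c,
    ⟨_, _, by positivity, by positivity, by rw [← add_div]; exact div_self hD.ne', rfl⟩,
    ⟨orient a c d / D, orient a b c / D, by positivity, by positivity, by
      rw [← add_div, ← hD']; exact div_self hD.ne', ?_⟩⟩
  simp only [div_eq_inv_mul, ← smul_smul, ← smul_add]
  rw [key]

/-- Barycentric coordinates: a point on the inner side of the three edges of a counterclockwise
triangle lies in the triangle. -/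
theorem mem_convexHull_triangle {a b c p : Plane} (hD : 0 < orient a b c)
    (h1 : 0 ≤ orient a b p) (h2 : 0 ≤ orient b c p) (h3 : 0 ≤ orient c a p) :
    p ∈ convexHull ℝ ({a, b, c} : Set Plane) := by
  have hs : orient b c p + orient c a p + orient a b p = orient a b c := by
    simp only [orient]; ring
  have hp : p = (orient b c p / orient a b c) • a + (orient c a p / orient a b c) • b
      + (orient a b p / orient a b c) • c := by
    have : orient a b c • p = orient b c p • a + orient c a p • b + orient a b p • c := by
      apply plane_ext <;>
      · simp only [orient, PiLp.add_apply, PiLp.smul_apply, smul_eq_mul]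
        ring
    simp only [div_eq_inv_mul, ← smul_smul, ← smul_add]
    rw [← this, smul_smul, inv_mul_cancel₀ hD.ne', one_smul]
  have hc := convex_convexHull ℝ ({a, b, c} : Set Plane)
  have hsub := subset_convexHull ℝ ({a, b, c} : Set Plane)
  have := hc.sum_mem (t := Finset.univ)
    (w := ![orient b c p / orient a b c, orient c a p / orient a b c, orient a b p / orient a b c])
    (z := ![a, b, c])
    (by
      intro i _
      fin_cases i
      · exact div_nonneg h2 hD.le
      · exact div_nonneg h3 hD.le
      · exact div_nonneg h1 hD.le)
    (by
      simp only [Fin.sum_univ_three, Matrix.cons_val_zero, Matrix.cons_val_one, Matrix.cons_val]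
      rw [← add_div, ← add_div, hs, div_self hD.ne'])
    (by
      intro i _
      fin_cases i
      · exact hsub (by simp)
      · exact hsub (by simp)
      · exact hsub (by simp))
  simp only [Fin.sum_univ_three, Matrix.cons_val_zero, Matrix.cons_val_one, Matrix.cons_val] at this
  rwa [hp]

theorem orient_nonneg_of_mem_convexHull {a b p : Plane} {s : Set Plane}
    (h : ∀ q ∈ s, 0 ≤ orient a b q) (hp : p ∈ convexHull ℝ s) : 0 ≤ orient a b p := by
  have hc : Convex ℝ {q : Plane | 0 ≤ orient a b q} := by
    intro x hx y hy t u ht hu htu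
    simp only [Set.mem_ofPred_eq] at hx hy ⊢
    rw [orient_combo a b x y htu]
    positivity
  exact convexHull_min h hc hp

theorem orient_nonpos_of_mem_convexHull {a b p : Plane} {s : Set Plane}
    (h : ∀ q ∈ s, orient a b q ≤ 0) (hp : p ∈ convexHull ℝ s) : orient a b p ≤ 0 := by
  have hswap : ∀ q, orient b a q = -orient a b q := fun q => by simp only [orient]; ring
  have := orient_nonneg_of_mem_convexHull (a := b) (b := a)
    (fun q hq => by rw [hswap]; linarith [h q hq]) hp
  rw [hswap] at this
  linarith

/-- The line `a b` supports the hull of `s`, so it meets the hull in the hull of the points of `s`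
on that line. -/
theorem mem_convexHull_of_orient_eq_zero {a b p : Plane} {s : Set Plane}
    (h : ∀ q ∈ s, 0 ≤ orient a b q) (hp : p ∈ convexHull ℝ s) (h0 : orient a b p = 0) :
    p ∈ convexHull ℝ {q ∈ s | orient a b q = 0} := by
  set F := convexHull ℝ {q ∈ s | orient a b q = 0}
  -- the open side of the line together with the face is a convex set containing `s`
  have hc : Convex ℝ {q : Plane | 0 < orient a b q ∨ (orient a b q = 0 ∧ q ∈ F)} := by
    intro x hx y hy t u ht hu htu
    simp only [Set.mem_ofPred_eq] at hx hy ⊢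
    rw [orient_combo a b x y htu]
    rcases ht.eq_or_lt with rfl | ht'
    · obtain rfl : u = 1 := by linarith
      simpa using hy
    rcases hu.eq_or_lt with rfl | hu'
    · obtain rfl : t = 1 := by linarith
      simpa using hx
    rcases hx with hx | ⟨hx, hxF⟩ <;> rcases hy with hy | ⟨hy, hyF⟩
    · left; positivity
    · left; rw [hy]; simp; positivity
    · left; rw [hx]; simp; positivity
    · right
      exact ⟨by rw [hx, hy]; simp, convex_convexHull ℝ _ hxF hyF ht hu htu⟩
  have hsub : s ⊆ {q : Plane | 0 < orient a b q ∨ (orient a b q = 0 ∧ q ∈ F)} := by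
    intro q hq
    rcases (h q hq).eq_or_lt with h' | h'
    · exact Or.inr ⟨h'.symm, subset_convexHull ℝ _ ⟨hq, h'.symm⟩⟩
    · exact Or.inl h'
  rcases convexHull_min hsub hc hp with h' | h'
  · exact absurd h0 h'.ne'
  · exact h'.2

theorem mem_convexHull_of_orient_eq_zero' {a b p : Plane} {s : Set Plane}
    (h : ∀ q ∈ s, orient a b q ≤ 0) (hp : p ∈ convexHull ℝ s) (h0 : orient a b p = 0) :
    p ∈ convexHull ℝ {q ∈ s | orient a b q = 0} := by
  have hswap : ∀ q, orient b a q = -orient a b q := fun q => by simp only [orient]; ring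
  have := mem_convexHull_of_orient_eq_zero (a := b) (b := a)
    (fun q hq => by rw [hswap]; linarith [h q hq]) hp (by rw [hswap, h0, neg_zero])
  simpa only [hswap, neg_eq_zero] using this

theorem exists_smul_of_orient_eq_zero {a b p : Plane} (hab : a ≠ b) (h : orient a b p = 0) :
    ∃ r : ℝ, p = a + r • (b - a) := by
  simp only [orient] at h
  by_cases h0 : b 0 - a 0 = 0
  · have h1 : b 1 - a 1 ≠ 0 := by
      intro h1
      exact hab (plane_ext (by linarith) (by linarith))
    refine ⟨(p 1 - a 1) / (b 1 - a 1), plane_ext ?_ ?_⟩ <;>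
      simp only [PiLp.add_apply, PiLp.smul_apply, PiLp.sub_apply, smul_eq_mul]
    · rw [h0] at h ⊢
      have : (b 1 - a 1) * (p 0 - a 0) = 0 := by linarith
      rcases mul_eq_zero.1 this with h' | h'
      · exact absurd h' h1
      · linarith
    · field_simp; ring
  · refine ⟨(p 0 - a 0) / (b 0 - a 0), plane_ext ?_ ?_⟩ <;>
      simp only [PiLp.add_apply, PiLp.smul_apply, PiLp.sub_apply, smul_eq_mul]
    · field_simp; ring
    · field_simp; linarith

theorem orient_add_smul (a b c : Plane) (r : ℝ) :
    orient a (a + r • (b - a)) c = r * orient a b c := by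
  simp only [orient, PiLp.add_apply, PiLp.smul_apply, PiLp.sub_apply, smul_eq_mul]
  ring

theorem affineIndependent_of_orient_pos {a b c : Plane} (h : 0 < orient a b c) :
    AffineIndependent ℝ ((↑) : (({a, b, c} : Finset Plane)) → Plane) := by
  have h3 : AffineIndependent ℝ ![a, b, c] := by
    rw [affineIndependent_iff_not_collinear_set, collinear_iff_of_mem (p₀ := a) (by simp)]
    rintro ⟨v, hv⟩
    obtain ⟨r, hr⟩ := hv b (by simp)
    obtain ⟨s, hs⟩ := hv c (by simp)
    rw [hr, hs] at h
    simp only [orient, vadd_eq_add, PiLp.add_apply, PiLp.smul_apply, smul_eq_mul] at h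
    ring_nf at h
    exact lt_irrefl _ h
  have := h3.range
  have hr : Set.range ![a, b, c] = ((({a, b, c} : Finset Plane)) : Set Plane) := by
    simp only [Matrix.range_cons, Matrix.range_empty, Set.singleton_union, insert_empty_eq,
      Finset.coe_insert, Finset.coe_singleton]
  rw [hr] at this
  exact this

theorem card_triple_of_orient_pos {a b c : Plane} (h : 0 < orient a b c) :
    ({a, b, c} : Finset Plane).card = 3 := by
  refine Finset.card_eq_three.2 ⟨a, b, c, ?_, ?_, ?_, rfl⟩
  · rintro rfl; simp at h
  · rintro rfl; simp at h
  · rintro rfl; simp at h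

/-- The vertices of a non-degenerate triangle do not lie on one line. -/
theorem exists_orient_ne_zero {a b : Plane} {Δ : Finset Plane} (hΔ : Δ.card = 3)
    (hind : AffineIndependent ℝ (fun Q : Δ => (Q : Plane))) (hab : a ≠ b) :
    ∃ q ∈ Δ, orient a b q ≠ 0 := by
  by_contra! hcon
  have hcol : Collinear ℝ (Δ : Set Plane) := by
    rw [collinear_iff_exists_forall_eq_smul_vadd]
    refine ⟨a, b - a, fun p hp => ?_⟩
    obtain ⟨r, hr⟩ := exists_smul_of_orient_eq_zero hab (hcon p hp)
    exact ⟨r, by rw [hr, vadd_eq_add, add_comm]⟩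
  obtain ⟨x, y, z, hxy, hxz, hyz, rfl⟩ := Finset.card_eq_three.1 hΔ
  rw [show ((({x, y, z} : Finset Plane)) : Set Plane) = {x, y, z} by simp,
    collinear_iff_not_affineIndependent_set] at hcol
  apply hcol
  have hinj : Function.Injective (fun i : Fin 3 =>
      (⟨![x, y, z] i, by fin_cases i <;> simp⟩ : ({x, y, z} : Finset Plane))) := by
    intro i j hij
    simp only [Subtype.mk.injEq] at hij
    fin_cases i <;> fin_cases j <;> simp_all
  exact hind.comp_embedding ⟨_, hinj⟩

/-! ### Faces of a triangulation -/

namespace IsTriangulation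

variable {S : Finset Plane} {T : Finset (Finset Plane)}

/-- Any two faces of triangles of a triangulation meet in the hull of their common vertices. -/
theorem convexHull_inter (h : IsTriangulation S T) {Δ Δ' : Finset Plane} (hΔ : Δ ∈ T)
    (hΔ' : Δ' ∈ T) {A B : Finset Plane} (hA : A ⊆ Δ) (hB : B ⊆ Δ') {p : Plane}
    (hpA : p ∈ convexHull ℝ (A : Set Plane)) (hpB : p ∈ convexHull ℝ (B : Set Plane)) :
    p ∈ convexHull ℝ ((A : Set Plane) ∩ B) := by
  have hp : p ∈ convexHull ℝ ((Δ : Set Plane) ∩ Δ') := by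
    by_cases heq : Δ = Δ'
    · subst heq
      rw [Set.inter_self]
      exact convexHull_mono (Finset.coe_subset.2 hA) hpA
    · rw [← h.face_to_face Δ hΔ Δ' hΔ' heq]
      exact ⟨convexHull_mono (Finset.coe_subset.2 hA) hpA,
        convexHull_mono (Finset.coe_subset.2 hB) hpB⟩
  have h1 : p ∈ convexHull ℝ ((A : Set Plane) ∩ ((Δ ∩ Δ' : Finset Plane) : Set Plane)) := by
    rw [AffineIndependent.convexHull_inter (h.nondegenerate Δ hΔ) hA Finset.inter_subset_left]
    exact ⟨hpA, by rwa [Finset.coe_inter]⟩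
  have h2 : p ∈ convexHull ℝ (((A ∩ (Δ ∩ Δ') : Finset Plane) : Set Plane) ∩ B) := by
    rw [AffineIndependent.convexHull_inter (h.nondegenerate Δ' hΔ')
      (fun q hq => by simp only [Finset.mem_inter] at hq; exact hq.2.2) hB]
    exact ⟨by rwa [Finset.coe_inter], hpB⟩
  refine convexHull_mono (fun q hq => ?_) h2
  simp only [Finset.coe_inter, Set.mem_inter_iff] at hq
  exact ⟨hq.1.1, hq.2⟩

/-- A vertex of one triangle that lies in another triangle is a vertex of it. -/
theorem mem_of_mem_convexHull (h : IsTriangulation S T) {Δ Δ' : Finset Plane} (hΔ : Δ ∈ T)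
    (hΔ' : Δ' ∈ T) {p : Plane} (hp : p ∈ Δ') (hpΔ : p ∈ convexHull ℝ (Δ : Set Plane)) :
    p ∈ Δ := by
  have := h.convexHull_inter hΔ hΔ' (A := Δ) (B := {p}) subset_rfl (by simpa using hp) hpΔ
    (by simp)
  by_contra hcon
  rw [Finset.coe_singleton, Set.inter_singleton_eq_empty.2 (by simpa using hcon), convexHull_empty] at this
  exact this

theorem not_crossing (h : IsTriangulation S T) {Δ Δ' : Finset Plane} (hΔ : Δ ∈ T)
    (hΔ' : Δ' ∈ T) {a b c d z : Plane} (ha : a ∈ Δ) (hb : b ∈ Δ) (hc : c ∈ Δ') (hd : d ∈ Δ')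
    (hz : z ∈ segment ℝ a b) (hz' : z ∈ segment ℝ c d) (hac : a ≠ c) (had : a ≠ d) (hbc : b ≠ c)
    (hbd : b ≠ d) : False := by
  rw [← convexHull_pair] at hz hz'
  have := h.convexHull_inter hΔ hΔ' (A := {a, b}) (B := {c, d})
    (by simp [Finset.insert_subset_iff, ha, hb]) (by simp [Finset.insert_subset_iff, hc, hd])
    (by simpa using hz) (by simpa using hz')
  have he : (({a, b} : Finset Plane) : Set Plane) ∩ ({c, d} : Finset Plane) = ∅ := by
    ext q
    simp only [Finset.coe_insert, Finset.coe_singleton, Set.mem_inter_iff, Set.mem_insert_iff, Set.mem_singleton_iff,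
      Set.mem_empty_iff_false, iff_false]
    rintro ⟨rfl | rfl, h' | h'⟩ <;> contradiction
  rw [he, convexHull_empty] at this
  exact this

theorem exists_mem_convexHull (h : IsTriangulation S T) {p : Plane}
    (hp : p ∈ convexHull ℝ (S : Set Plane)) : ∃ Δ ∈ T, p ∈ convexHull ℝ (Δ : Set Plane) := by
  rw [h.covers] at hp
  simpa using hp

end IsTriangulation

theorem mem_usedPoints {T : Finset (Finset Plane)} {p : Plane} :
    p ∈ usedPoints T ↔ ∃ Δ ∈ T, p ∈ Δ := by
  simp [usedPoints]

/-! ### Weakly convex chains -/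

/-- The points `w i, …, w j` are distinct and form a weakly convex chain: they turn left,
or go straight on, at every triple. The segment from `w j` back to `w i` closes the chain to a
weakly convex polygon. -/
structure IsConvexChain (w : ℕ → Plane) (i j : ℕ) : Prop where
  injOn : Set.InjOn w (Set.Icc i j)
  orient_nonneg : ∀ x y z, i ≤ x → x < y → y < z → z ≤ j → 0 ≤ orient (w x) (w y) (w z)

/-- The set of points of the chain `w i, …, w j`. -/
noncomputable def chainPoints (w : ℕ → Plane) (i j : ℕ) : Finset Plane :=
  (Finset.Icc i j).image w

theorem mem_chainPoints {w : ℕ → Plane} {i j : ℕ} {p : Plane} :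
    p ∈ chainPoints w i j ↔ ∃ x, i ≤ x ∧ x ≤ j ∧ w x = p := by
  simp [chainPoints, and_assoc]

theorem mem_chainPoints_of_le {w : ℕ → Plane} {i j x : ℕ} (h1 : i ≤ x) (h2 : x ≤ j) :
    w x ∈ chainPoints w i j :=
  mem_chainPoints.2 ⟨x, h1, h2, rfl⟩

theorem chainPoints_mono {w : ℕ → Plane} {i j i' j' : ℕ} (h1 : i' ≤ i) (h2 : j ≤ j') :
    chainPoints w i j ⊆ chainPoints w i' j' := by
  intro p hp
  obtain ⟨x, hx1, hx2, rfl⟩ := mem_chainPoints.1 hp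
  exact mem_chainPoints_of_le (h1.trans hx1) (hx2.trans h2)

open Classical in
/-- The triangulations of the polygon `w i, …, w j` that use all of its points. A chain with a
single edge counts as having one such triangulation, the empty one. -/
noncomputable def fullTriangulations (w : ℕ → Plane) (i j : ℕ) :
    Finset (Finset (Finset Plane)) :=
  if j = i + 1 then {∅}
  else (triangulations (chainPoints w i j)).filter (fun T => usedPoints T = chainPoints w i j)

theorem mem_fullTriangulations {w : ℕ → Plane} {i j : ℕ} (h : j ≠ i + 1)
    {T : Finset (Finset Plane)} :
    T ∈ fullTriangulations w i j ↔
      IsTriangulation (chainPoints w i j) T ∧ usedPoints T = chainPoints w i j := by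
  classical
  simp [fullTriangulations, h, mem_triangulations]

namespace IsConvexChain

variable {w : ℕ → Plane} {i j k : ℕ} {T : Finset (Finset Plane)}

theorem mono (h : IsConvexChain w i j) {i' j' : ℕ} (h1 : i ≤ i') (h2 : j' ≤ j) :
    IsConvexChain w i' j' where
  injOn := h.injOn.mono (Set.Icc_subset_Icc h1 h2)
  orient_nonneg x y z hx hxy hyz hz :=
    h.orient_nonneg x y z (h1.trans hx) hxy hyz (hz.trans h2)

theorem orient_nonneg_of_le (h : IsConvexChain w i j) {x y z : ℕ} (hx : i ≤ x) (hxy : x ≤ y)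
    (hyz : y ≤ z) (hz : z ≤ j) : 0 ≤ orient (w x) (w y) (w z) := by
  rcases hxy.eq_or_lt with rfl | hxy
  · simp
  rcases hyz.eq_or_lt with rfl | hyz
  · simp
  exact h.orient_nonneg x y z hx hxy hyz hz

theorem ne (h : IsConvexChain w i j) {x y : ℕ} (hx : i ≤ x) (hx' : x ≤ j) (hy : i ≤ y)
    (hy' : y ≤ j) (hxy : x ≠ y) : w x ≠ w y :=
  fun he => hxy (h.injOn ⟨hx, hx'⟩ ⟨hy, hy'⟩ he)

theorem mem_chainPoints_iff (h : IsConvexChain w i j) {a b x : ℕ} (ha : i ≤ a) (hb : b ≤ j)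
    (hx : i ≤ x) (hx' : x ≤ j) : w x ∈ chainPoints w a b ↔ a ≤ x ∧ x ≤ b := by
  constructor
  · intro hm
    obtain ⟨y, hy1, hy2, hy⟩ := mem_chainPoints.1 hm
    obtain rfl := h.injOn ⟨ha.trans hy1, hy2.trans hb⟩ ⟨hx, hx'⟩ hy
    exact ⟨hy1, hy2⟩
  · rintro ⟨h1, h2⟩
    exact mem_chainPoints_of_le h1 h2

/-- The diagonals `w a, w c` and `w b, w d` with `a < b < c < d` cannot both be edges of
triangles of a triangulation, unless the four points are collinear. -/
theorem not_crossing (h : IsConvexChain w i j) {S : Finset Plane} (hT : IsTriangulation S T)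
    {Δ Δ' : Finset Plane} (hΔ : Δ ∈ T) (hΔ' : Δ' ∈ T) {a b c d : ℕ} (ha : i ≤ a) (hab : a < b)
    (hbc : b < c) (hcd : c < d) (hd : d ≤ j) (hD : 0 < orient (w b) (w c) (w d) +
      orient (w a) (w b) (w d))
    (haΔ : w a ∈ Δ) (hcΔ : w c ∈ Δ) (hbΔ : w b ∈ Δ') (hdΔ : w d ∈ Δ') : False := by
  obtain ⟨z, hz, hz'⟩ := exists_mem_segment_inter
    (h.orient_nonneg_of_le (x := b) (y := c) (z := d) (by omega) (by omega) (by omega) hd)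
    (h.orient_nonneg_of_le (x := a) (y := b) (z := d) (by omega) (by omega) (by omega) hd)
    (h.orient_nonneg_of_le (x := a) (y := c) (z := d) (by omega) (by omega) (by omega) hd)
    (h.orient_nonneg_of_le (x := a) (y := b) (z := c) (by omega) (by omega) (by omega) (by omega))
    hD
  exact hT.not_crossing hΔ hΔ' haΔ hcΔ hbΔ hdΔ hz hz' (h.ne ha (by omega) (by omega) (by omega)
    (by omega)) (h.ne (by omega) (by omega) (by omega) (by omega) (by omega))
    (h.ne (by omega) (by omega) (by omega) (by omega) (by omega))
    (h.ne (by omega) (by omega) (by omega) (by omega) (by omega))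

/-- If the chain is not straight, then no point of it lies between the end points on the closing
segment. -/
theorem not_mem_openSegment (h : IsConvexChain w i j) {x : ℕ} (hik : i ≤ k) (hkj : k ≤ j)
    (hk : 0 < orient (w i) (w k) (w j)) (hx : i ≤ x) (hxj : x ≤ j) {r : ℝ} (hr0 : 0 < r)
    (hr1 : r < 1) (he : w x = w i + r • (w j - w i)) : False := by
  rcases le_total k x with hkx | hxk
  · have := h.orient_nonneg_of_le hik hkx hxj le_rfl
    have e : orient (w k) (w x) (w j) = -((1 - r) * orient (w i) (w k) (w j)) := by
      rw [he]
      simp only [orient, PiLp.add_apply, PiLp.smul_apply, PiLp.sub_apply, smul_eq_mul]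
      ring
    have : 0 < (1 - r) * orient (w i) (w k) (w j) := mul_pos (by linarith) hk
    linarith
  · have := h.orient_nonneg_of_le le_rfl hx hxk hkj
    have e : orient (w i) (w x) (w k) = -(r * orient (w i) (w k) (w j)) := by
      rw [he, orient_add_smul, orient_swap]; ring
    have : 0 < r * orient (w i) (w k) (w j) := mul_pos hr0 hk
    linarith

/-- Every full triangulation has a triangle on the closing edge: the one that contains its
midpoint. -/
theorem exists_base_triangle (h : IsConvexChain w i j) (hij : i < j)
    (hT : IsTriangulation (chainPoints w i j) T) (hU : usedPoints T = chainPoints w i j) :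
    ∃ k, i < k ∧ k < j ∧ 0 < orient (w i) (w k) (w j) ∧ {w i, w k, w j} ∈ T := by
  have hne : w i ≠ w j := h.ne le_rfl hij.le hij.le le_rfl hij.ne
  have hi : w i ∈ chainPoints w i j := mem_chainPoints_of_le le_rfl hij.le
  have hj : w j ∈ chainPoints w i j := mem_chainPoints_of_le hij.le le_rfl
  have hside : ∀ q ∈ chainPoints w i j, orient (w i) (w j) q ≤ 0 := by
    intro q hq
    obtain ⟨x, hx, hx', rfl⟩ := mem_chainPoints.1 hq
    rw [orient_swap]
    linarith [h.orient_nonneg_of_le le_rfl hx hx' le_rfl]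
  set M : Plane := (1 / 2 : ℝ) • w i + (1 / 2 : ℝ) • w j with hM
  have hMS : M ∈ convexHull ℝ (chainPoints w i j : Set Plane) :=
    convex_convexHull ℝ _ (subset_convexHull ℝ _ (Finset.mem_coe.2 hi))
      (subset_convexHull ℝ _ (Finset.mem_coe.2 hj)) (by norm_num) (by norm_num) (by norm_num)
  obtain ⟨Δ, hΔ, hMΔ⟩ := hT.exists_mem_convexHull hMS
  have hsub := hT.vertices_subset Δ hΔ
  -- the triangle has a vertex off the line of the closing edge
  obtain ⟨q, hq, hq0⟩ := exists_orient_ne_zero (hT.card_eq_three Δ hΔ) (hT.nondegenerate Δ hΔ) hne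
  obtain ⟨k, hk, hk', rfl⟩ := mem_chainPoints.1 (hsub hq)
  have hkpos : 0 < orient (w i) (w k) (w j) := by
    have := hside _ (hsub hq)
    rw [orient_swap]
    exact neg_pos.2 (lt_of_le_of_ne this hq0)
  have hik : i < k := lt_of_le_of_ne hk (by rintro rfl; simp at hkpos)
  have hkj : k < j := lt_of_le_of_ne hk' (by rintro rfl; simp at hkpos)
  have hMF := mem_convexHull_of_orient_eq_zero' (s := (Δ : Set Plane)) (a := w i) (b := w j)
    (fun q hq => hside q (hsub hq)) hMΔ (by
      rw [hM, orient_combo _ _ _ _ (by norm_num)]; simp)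
  set F := {q ∈ (Δ : Set Plane) | orient (w i) (w j) q = 0} with hF
  -- `r` is the affine coordinate along the closing edge
  have hu : ∀ q ∈ F, ∃ r : ℝ, q = w i + r • (w j - w i) ∧ (r ≤ 0 ∨ 1 ≤ r) := by
    rintro q ⟨hqΔ, hq0⟩
    obtain ⟨r, hr⟩ := exists_smul_of_orient_eq_zero hne hq0
    refine ⟨r, hr, ?_⟩
    by_contra! hcon
    obtain ⟨x, hx, hx', rfl⟩ := mem_chainPoints.1 (hsub hqΔ)
    exact h.not_mem_openSegment hik.le hkj.le hkpos hx hx' hcon.1 hcon.2 hr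
  have hne' : w j - w i ≠ 0 := sub_ne_zero.2 hne.symm
  have hMr : M = w i + (1 / 2 : ℝ) • (w j - w i) := by
    rw [hM]; module
  -- points of the hull of `F` on both sides of the midpoint
  have hlow : ∃ q ∈ F, ∃ r : ℝ, q = w i + r • (w j - w i) ∧ r ≤ 0 := by
    by_contra! hcon
    have hc : Convex ℝ {p : Plane | ∃ r : ℝ, p = w i + r • (w j - w i) ∧ 1 ≤ r} := by
      rintro _ ⟨r, rfl, hr⟩ _ ⟨s, rfl, hs⟩ a b ha hb hab
      refine ⟨a * r + b * s, ?_, by nlinarith⟩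
      obtain rfl : a = 1 - b := by linarith
      module
    obtain ⟨r, hr, hr1⟩ := convexHull_min (fun q hq => by
      obtain ⟨r, hr, hr'⟩ := hu q hq
      rcases hr' with hr' | hr'
      · exact absurd hr' (not_le.2 (hcon q hq r hr))
      · exact ⟨r, hr, hr'⟩) hc hMF
    rw [hMr] at hr
    have := smul_left_injective ℝ hne' (add_left_cancel hr)
    linarith
  have hhigh : ∃ q ∈ F, ∃ r : ℝ, q = w i + r • (w j - w i) ∧ 1 ≤ r := by
    by_contra! hcon
    have hc : Convex ℝ {p : Plane | ∃ r : ℝ, p = w i + r • (w j - w i) ∧ r ≤ 0} := by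
      rintro _ ⟨r, rfl, hr⟩ _ ⟨s, rfl, hs⟩ a b ha hb hab
      refine ⟨a * r + b * s, ?_, by nlinarith⟩
      obtain rfl : a = 1 - b := by linarith
      module
    obtain ⟨r, hr, hr1⟩ := convexHull_min (fun q hq => by
      obtain ⟨r, hr, hr'⟩ := hu q hq
      rcases hr' with hr' | hr'
      · exact ⟨r, hr, hr'⟩
      · exact absurd hr' (not_le.2 (hcon q hq r hr))) hc hMF
    rw [hMr] at hr
    have := smul_left_injective ℝ hne' (add_left_cancel hr)
    linarith
  obtain ⟨q₁, hq₁, r₁, hr₁, hr₁'⟩ := hlow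
  obtain ⟨q₂, hq₂, r₂, hr₂, hr₂'⟩ := hhigh
  have hmem : ∀ r : ℝ, 0 ≤ r → r ≤ 1 → w i + r • (w j - w i) ∈ convexHull ℝ (Δ : Set Plane) := by
    intro r h0 h1
    have hpos : 0 < r₂ - r₁ := by linarith
    have := convex_convexHull ℝ (Δ : Set Plane) (subset_convexHull ℝ _ hq₁.1)
      (subset_convexHull ℝ _ hq₂.1) (a := (r₂ - r) / (r₂ - r₁)) (b := (r - r₁) / (r₂ - r₁))
      (div_nonneg (by linarith) hpos.le) (div_nonneg (by linarith) hpos.le)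
      (by field_simp; ring)
    convert this using 1
    rw [hr₁, hr₂]
    have e1 : (r₂ - r) / (r₂ - r₁) = 1 - (r - r₁) / (r₂ - r₁) := by field_simp; ring
    have e2 : r = r₁ + (r - r₁) / (r₂ - r₁) * (r₂ - r₁) := by field_simp; ring
    rw [e1]
    generalize (r - r₁) / (r₂ - r₁) = s at e2 ⊢
    rw [e2]
    module
  have hmemΔ : ∀ p ∈ chainPoints w i j, p ∈ convexHull ℝ (Δ : Set Plane) → p ∈ Δ := by
    intro p hp hpΔ
    rw [← hU] at hp
    obtain ⟨Δ', hΔ', hp'⟩ := mem_usedPoints.1 hp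
    exact hT.mem_of_mem_convexHull hΔ hΔ' hp' hpΔ
  have hiΔ : w i ∈ Δ := hmemΔ _ hi (by simpa using hmem 0 le_rfl zero_le_one)
  have hjΔ : w j ∈ Δ := hmemΔ _ hj (by simpa using hmem 1 zero_le_one le_rfl)
  refine ⟨k, hik, hkj, hkpos, ?_⟩
  have : ({w i, w k, w j} : Finset Plane) = Δ :=
    Finset.eq_of_subset_of_card_le (by simp [Finset.insert_subset_iff, hiΔ, hjΔ, hq])
      (by rw [hT.card_eq_three Δ hΔ, card_triple_of_orient_pos hkpos])
  rwa [this]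

end IsConvexChain

/-! ### Cutting and gluing along a base triangle -/

/-- If every triangle of a triangulation of `S` either has its vertices in `P` or lies on the other
side of the line `u v`, then the triangles with vertices in `P` triangulate `P`. -/
theorem IsTriangulation.filter_subset {S P : Finset Plane} {T : Finset (Finset Plane)}
    (hT : IsTriangulation S T) (hPS : P ⊆ S) {u v q : Plane} (hP : ∀ p ∈ P, orient u v p ≤ 0)
    (hq : q ∈ P) (hq0 : orient u v q < 0)
    (hsplit : ∀ Δ ∈ T, Δ ⊆ P ∨ ∀ p ∈ Δ, 0 ≤ orient u v p) :
    IsTriangulation P (T.filter (· ⊆ P)) where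
  vertices_subset Δ hΔ := (Finset.mem_filter.1 hΔ).2
  card_eq_three Δ hΔ := hT.card_eq_three Δ (Finset.mem_filter.1 hΔ).1
  nondegenerate Δ hΔ := hT.nondegenerate Δ (Finset.mem_filter.1 hΔ).1
  face_to_face Δ hΔ Δ' hΔ' :=
    hT.face_to_face Δ (Finset.mem_filter.1 hΔ).1 Δ' (Finset.mem_filter.1 hΔ').1
  covers := by
    set K := ⋃ Δ ∈ T.filter (· ⊆ P), convexHull ℝ (Δ : Set Plane) with hK
    have hclosed : IsClosed K :=
      Set.Finite.isClosed_biUnion (T.filter (· ⊆ P)).finite_toSet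
        (fun Δ _ => Δ.finite_toSet.isClosed_convexHull ℝ)
    have hstrict : ∀ p ∈ convexHull ℝ (P : Set Plane), orient u v p < 0 → p ∈ K := by
      intro p hp hp0
      obtain ⟨Δ, hΔ, hpΔ⟩ :=
        hT.exists_mem_convexHull (convexHull_mono (Finset.coe_subset.2 hPS) hp)
      rcases hsplit Δ hΔ with h | h
      · exact Set.mem_biUnion (Finset.mem_filter.2 ⟨hΔ, h⟩) hpΔ
      · exact absurd (orient_nonneg_of_mem_convexHull h hpΔ) (not_le.2 hp0)
    apply Set.Subset.antisymm
    · intro p hp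
      have hqP := subset_convexHull ℝ (P : Set Plane) (Finset.mem_coe.2 hq)
      -- points strictly between `p` and `q` are strictly below the line `u v`
      have hmem : ∀ t ∈ Set.Ioo (0 : ℝ) 1, (1 - t) • p + t • q ∈ K := by
        rintro t ⟨ht0, ht1⟩
        apply hstrict
        · exact convex_convexHull ℝ _ hp hqP (by linarith) ht0.le (by ring)
        · rw [orient_combo _ _ _ _ (by ring)]
          have := orient_nonpos_of_mem_convexHull hP hp
          nlinarith
      have hcont : ContinuousWithinAt (fun t : ℝ => (1 - t) • p + t • q) (Set.Ioo 0 1) 0 := by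
        apply Continuous.continuousWithinAt; fun_prop
      have h0 := hcont.mem_closure (by rw [closure_Ioo zero_ne_one]; simp) hmem
      rw [hclosed.closure_eq] at h0
      simpa using h0
    · refine Set.iUnion₂_subset fun Δ hΔ => convexHull_mono ?_
      exact Finset.coe_subset.2 (Finset.mem_filter.1 hΔ).2

/-- A hull of two sets `P`, `Q` separated by the line `u v` contains nothing new beyond the line,
provided that segments from `P` to `Q` cross the line between `u` and `v`. -/
theorem mem_convexHull_of_orient_neg {P Q : Set Plane} {u v p : Plane} (hu : u ∈ P) (hv : v ∈ P)
    (hQ0 : Q.Nonempty) (hP : ∀ q ∈ P, orient u v q ≤ 0) (hQ : ∀ q ∈ Q, 0 ≤ orient u v q)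
    (hcross : ∀ a ∈ convexHull ℝ P, ∀ b ∈ convexHull ℝ Q, orient u v a < 0 →
      ∃ z, z ∈ segment ℝ u v ∧ z ∈ segment ℝ a b)
    (hp : p ∈ convexHull ℝ (P ∪ Q)) (hp0 : orient u v p < 0) : p ∈ convexHull ℝ P := by
  rw [convexHull_union ⟨u, hu⟩ hQ0, mem_convexJoin] at hp
  obtain ⟨a, ha, b, hb, hp⟩ := hp
  obtain ⟨s, t, hs, ht, hst, rfl⟩ := hp
  rw [orient_combo _ _ _ _ hst] at hp0
  have ha0 := orient_nonpos_of_mem_convexHull hP ha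
  have hb0 := orient_nonneg_of_mem_convexHull hQ hb
  have ha' : orient u v a < 0 := by
    by_contra hcon
    have : orient u v a = 0 := by linarith
    rw [this] at hp0
    nlinarith
  obtain ⟨z, hz, s', t', hs', ht', hst', hz'⟩ := hcross a ha b hb ha'
  have hz0 : orient u v z = 0 := by
    obtain ⟨x, y, -, -, hxy, rfl⟩ := hz
    rw [orient_combo _ _ _ _ hxy]; simp
  have hzP : z ∈ convexHull ℝ P :=
    (convex_convexHull ℝ P).segment_subset (subset_convexHull ℝ _ hu) (subset_convexHull ℝ _ hv) hz
  have hz1 := hz0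
  rw [← hz', orient_combo _ _ _ _ hst'] at hz1
  -- the point lies on the part of the segment between `a` and `z`
  have htt : t < t' := by
    by_contra! hcon
    have h1 : t' * orient u v b ≤ t * orient u v b := mul_le_mul_of_nonneg_right hcon hb0
    have h2 : s' * orient u v a ≤ s * orient u v a :=
      mul_le_mul_of_nonpos_right (by linarith) ha0
    linarith
  have hpos : 0 < t' := by linarith
  have := convex_convexHull ℝ P ha hzP (a := 1 - t / t') (b := t / t')
    (by rw [sub_nonneg, div_le_one hpos]; exact htt.le) (by positivity) (by ring)
  convert this using 1
  obtain rfl : s = 1 - t := by linarith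
  obtain rfl : s' = 1 - t' := by linarith
  rw [← hz']
  have e : t = t / t' * t' := by field_simp
  generalize t / t' = r at e ⊢
  rw [e]
  module

/-- A triangle `Δ` glued to a triangulation of `P` along an edge `u v` of the latter meets its
triangles in common faces. -/
theorem IsTriangulation.mem_convexHull_inter_of_edge {P : Finset Plane}
    {T : Finset (Finset Plane)} (hT : IsTriangulation P T) {u v c p : Plane}
    (hP : ∀ q ∈ P, orient u v q ≤ 0) (hc : 0 < orient u v c) {Δ Δ₁ Δ' : Finset Plane}
    (hΔ : ∀ q, q ∈ Δ ↔ q = u ∨ q = v ∨ q = c) (hΔ₁ : Δ₁ ∈ T) (hu : u ∈ Δ₁) (hv : v ∈ Δ₁)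
    (hΔ' : Δ' ∈ T) (hp : p ∈ convexHull ℝ (Δ : Set Plane))
    (hp' : p ∈ convexHull ℝ (Δ' : Set Plane)) :
    p ∈ convexHull ℝ ((Δ : Set Plane) ∩ Δ') := by
  have hΔ0 : ∀ q ∈ (Δ : Set Plane), 0 ≤ orient u v q := by
    intro q hq
    rcases (hΔ q).1 hq with rfl | rfl | rfl
    · simp
    · simp
    · exact hc.le
  have h0 : orient u v p = 0 :=
    le_antisymm
      (orient_nonpos_of_mem_convexHull (fun q hq => hP q (hT.vertices_subset Δ' hΔ' hq)) hp')
      (orient_nonneg_of_mem_convexHull hΔ0 hp)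
  have hpuv : p ∈ convexHull ℝ (({u, v} : Finset Plane) : Set Plane) := by
    refine convexHull_mono ?_ (mem_convexHull_of_orient_eq_zero hΔ0 hp h0)
    rintro q ⟨hq, hq0⟩
    rcases (hΔ q).1 hq with rfl | rfl | rfl
    · simp
    · simp
    · exact absurd hq0 hc.ne'
  have := hT.convexHull_inter hΔ₁ hΔ' (A := {u, v}) (B := Δ')
    (by simp [Finset.insert_subset_iff, hu, hv]) subset_rfl hpuv hp'
  refine convexHull_mono (fun q hq => Set.mem_inter ?_ hq.2) this
  have hq1 := hq.1
  simp only [Finset.coe_insert, Finset.coe_singleton, Set.mem_insert_iff,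
    Set.mem_singleton_iff] at hq1
  exact (hΔ q).2 (by tauto)

namespace IsConvexChain

variable {w : ℕ → Plane} {i j k : ℕ} {T T₁ T₂ : Finset (Finset Plane)}

theorem orient_nonpos_left (h : IsConvexChain w i j) (hkj : k < j) :
    ∀ p ∈ chainPoints w i k, orient (w i) (w k) p ≤ 0 := by
  intro p hp
  obtain ⟨x, hx, hx', rfl⟩ := mem_chainPoints.1 hp
  rw [orient_swap]
  linarith [h.orient_nonneg_of_le le_rfl hx hx' hkj.le]

theorem orient_nonneg_left (h : IsConvexChain w i j) (hik : i < k) :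
    ∀ p ∈ chainPoints w k j, 0 ≤ orient (w i) (w k) p := by
  intro p hp
  obtain ⟨x, hx, hx', rfl⟩ := mem_chainPoints.1 hp
  exact h.orient_nonneg_of_le le_rfl hik.le hx hx'

theorem orient_nonpos_right (h : IsConvexChain w i j) (hik : i < k) :
    ∀ p ∈ chainPoints w k j, orient (w k) (w j) p ≤ 0 := by
  intro p hp
  obtain ⟨x, hx, hx', rfl⟩ := mem_chainPoints.1 hp
  rw [orient_swap]
  linarith [h.orient_nonneg_of_le hik.le hx hx' le_rfl]

theorem orient_nonneg_right (h : IsConvexChain w i j) (hkj : k < j) :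
    ∀ p ∈ chainPoints w i k, 0 ≤ orient (w k) (w j) p := by
  intro p hp
  obtain ⟨x, hx, hx', rfl⟩ := mem_chainPoints.1 hp
  rw [orient_rotate]
  exact h.orient_nonneg_of_le hx hx' hkj.le le_rfl

section Cut

variable (h : IsConvexChain w i j) (hik : i < k) (hkj : k < j)
  (hk : 0 < orient (w i) (w k) (w j)) (hT : IsTriangulation (chainPoints w i j) T)
  (hU : usedPoints T = chainPoints w i j) (hΔ : {w i, w k, w j} ∈ T)

include h hik hkj hT hU hΔ in
theorem index_eq_of_mem_base {x : ℕ} (hx : i ≤ x) (hx' : x ≤ j)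
    (hm : w x ∈ convexHull ℝ ({w i, w k, w j} : Set Plane)) : x = i ∨ x = k ∨ x = j := by
  have hxS : w x ∈ usedPoints T := by rw [hU]; exact mem_chainPoints_of_le hx hx'
  obtain ⟨Δ', hΔ', hxΔ'⟩ := mem_usedPoints.1 hxS
  have := hT.mem_of_mem_convexHull hΔ hΔ' hxΔ' (by simpa using hm)
  simp only [Finset.mem_insert, Finset.mem_singleton] at this
  rcases this with he | he | he
  · exact Or.inl (h.injOn ⟨hx, hx'⟩ ⟨le_rfl, by omega⟩ he)
  · exact Or.inr (Or.inl (h.injOn ⟨hx, hx'⟩ ⟨hik.le, hkj.le⟩ he))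
  · exact Or.inr (Or.inr (h.injOn ⟨hx, hx'⟩ ⟨by omega, le_rfl⟩ he))

include h hik hkj hk hT hU hΔ

/-- A full triangulation has no vertex on the left edge of its base triangle. -/
theorem orient_pos_left {x : ℕ} (hx : i < x) (hx' : x < k) : 0 < orient (w i) (w x) (w k) := by
  refine lt_of_le_of_ne (h.orient_nonneg_of_le le_rfl hx.le hx'.le hkj.le) fun h0 => ?_
  have := h.index_eq_of_mem_base hik hkj hT hU hΔ (x := x) (by omega) (by omega)
    (mem_convexHull_triangle hk (by rw [orient_swap]; linarith)
      (by rw [orient_rotate]; exact h.orient_nonneg_of_le hx.le hx'.le hkj.le le_rfl)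
      (by rw [← orient_rotate]; exact h.orient_nonneg_of_le le_rfl hx.le (by omega) le_rfl))
  omega

theorem orient_pos_right {x : ℕ} (hx : k < x) (hx' : x < j) : 0 < orient (w k) (w x) (w j) := by
  refine lt_of_le_of_ne (h.orient_nonneg_of_le hik.le hx.le hx'.le le_rfl) fun h0 => ?_
  have := h.index_eq_of_mem_base hik hkj hT hU hΔ (x := x) (by omega) (by omega)
    (mem_convexHull_triangle hk (h.orient_nonneg_of_le le_rfl hik.le hx.le hx'.le)
      (by rw [orient_swap]; linarith)
      (by rw [← orient_rotate]; exact h.orient_nonneg_of_le le_rfl (by omega) (by omega) le_rfl))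
  omega

/-- All other triangles lie on one side of the base triangle. -/
theorem subset_or_subset_of_mem {Δ' : Finset Plane} (hΔ' : Δ' ∈ T) :
    Δ' = {w i, w k, w j} ∨ Δ' ⊆ chainPoints w i k ∨ Δ' ⊆ chainPoints w k j := by
  by_contra! hcon
  obtain ⟨hne, h1, h2⟩ := hcon
  have hsub := hT.vertices_subset Δ' hΔ'
  obtain ⟨p, hp, hp'⟩ := Finset.not_subset.1 h1
  obtain ⟨y, hy, hy', rfl⟩ := mem_chainPoints.1 (hsub hp)
  obtain ⟨p, hq, hq'⟩ := Finset.not_subset.1 h2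
  obtain ⟨x, hx, hx', rfl⟩ := mem_chainPoints.1 (hsub hq)
  have hky : k < y := by
    by_contra hcon
    exact hp' (mem_chainPoints_of_le hy (by omega))
  have hxk : x < k := by
    by_contra hcon
    exact hq' (mem_chainPoints_of_le (by omega) hx')
  rcases hx.eq_or_lt with rfl | hix
  · rcases hy'.eq_or_lt with rfl | hyj
    · -- a different triangle on the base edge crosses one of the two other edges
      obtain ⟨r, hr, hr'⟩ : ∃ r ∈ Δ', r ∉ ({w i, w k, w y} : Finset Plane) := by
        by_contra! hcon
        exact hne (Finset.eq_of_subset_of_card_le hcon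
          (by rw [card_triple_of_orient_pos hk, hT.card_eq_three Δ' hΔ']))
      obtain ⟨m, hm, hm', rfl⟩ := mem_chainPoints.1 (hsub hr)
      simp only [Finset.mem_insert, Finset.mem_singleton, not_or] at hr'
      have hmi : m ≠ i := by rintro rfl; exact hr'.1 rfl
      have hmk : m ≠ k := by rintro rfl; exact hr'.2.1 rfl
      have hmj : m ≠ y := by rintro rfl; exact hr'.2.2 rfl
      rcases lt_or_gt_of_ne hmk with hmk | hmk
      · refine h.not_crossing hT hΔ hΔ' (a := i) (b := m) (c := k) (d := y) le_rfl (by omega)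
          hmk hky le_rfl ?_ (by simp) (by simp) hr hp
        rw [orient_add_orient]
        linarith [h.orient_nonneg_of_le (x := i) (y := m) (z := k) le_rfl hm hmk.le hkj.le]
      · refine h.not_crossing hT hΔ' hΔ (a := i) (b := k) (c := m) (d := y) le_rfl hik
          hmk (by omega) le_rfl ?_ hq hr (by simp) (by simp)
        linarith [h.orient_nonneg_of_le (x := k) (y := m) (z := y) hik.le hmk.le hm' le_rfl]
    · refine h.not_crossing hT hΔ' hΔ (a := i) (b := k) (c := y) (d := j) le_rfl hik
        hky hyj le_rfl ?_ hq hp (by simp) (by simp)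
      linarith [h.orient_nonneg_of_le (x := k) (y := y) (z := j) hik.le hky.le hy' le_rfl]
  · refine h.not_crossing hT hΔ hΔ' (a := i) (b := x) (c := k) (d := y) le_rfl hix
      hxk hky hy' ?_ (by simp) (by simp) hq hp
    rw [orient_add_orient]
    linarith [h.orient_pos_left hik hkj hk hT hU hΔ hix hxk,
      h.orient_nonneg_of_le (x := i) (y := k) (z := y) le_rfl hik.le hky.le hy']

theorem filter_left_mem :
    T.filter (· ⊆ chainPoints w i k) ∈ fullTriangulations w i k := by
  by_cases hki : k = i + 1
  · have hT0 : T.filter (· ⊆ chainPoints w i k) = ∅ := by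
      rw [Finset.filter_eq_empty_iff]
      intro Δ' hΔ' hsub
      have h1 := Finset.card_le_card hsub
      rw [hT.card_eq_three Δ' hΔ'] at h1
      have h2 : (chainPoints w i k).card ≤ (Finset.Icc i k).card := Finset.card_image_le
      rw [Nat.card_Icc] at h2
      omega
    rw [hT0]
    simp [fullTriangulations, hki]
  · have hpos := h.orient_pos_left hik hkj hk hT hU hΔ (x := i + 1) (by omega) (by omega)
    have hTL : IsTriangulation (chainPoints w i k) (T.filter (· ⊆ chainPoints w i k)) := by
      refine hT.filter_subset (chainPoints_mono le_rfl hkj.le) (h.orient_nonpos_left hkj)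
        (mem_chainPoints_of_le (x := i + 1) (by omega) (by omega))
        (by rw [orient_swap]; linarith) fun Δ' hΔ' => ?_
      rcases h.subset_or_subset_of_mem hik hkj hk hT hU hΔ hΔ' with rfl | h' | h'
      · right
        intro p hp
        simp only [Finset.mem_insert, Finset.mem_singleton] at hp
        rcases hp with rfl | rfl | rfl
        · simp
        · simp
        · exact hk.le
      · exact Or.inl h'
      · exact Or.inr fun p hp => h.orient_nonneg_left hik p (h' hp)
    rw [mem_fullTriangulations hki]
    refine ⟨hTL, Finset.Subset.antisymm ?_ ?_⟩
    · intro p hp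
      obtain ⟨Δ', hΔ', hp'⟩ := mem_usedPoints.1 hp
      exact hTL.vertices_subset Δ' hΔ' hp'
    · intro p hp
      obtain ⟨Δ', hΔ', hp'⟩ := hTL.exists_mem_convexHull (subset_convexHull ℝ _ hp)
      have hpU : p ∈ usedPoints T := by rw [hU]; exact chainPoints_mono le_rfl hkj.le hp
      obtain ⟨Δ'', hΔ'', hp''⟩ := mem_usedPoints.1 hpU
      exact mem_usedPoints.2 ⟨Δ', hΔ',
        hT.mem_of_mem_convexHull (Finset.mem_filter.1 hΔ').1 hΔ'' hp'' hp'⟩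

theorem filter_right_mem :
    T.filter (· ⊆ chainPoints w k j) ∈ fullTriangulations w k j := by
  by_cases hki : j = k + 1
  · have hT0 : T.filter (· ⊆ chainPoints w k j) = ∅ := by
      rw [Finset.filter_eq_empty_iff]
      intro Δ' hΔ' hsub
      have h1 := Finset.card_le_card hsub
      rw [hT.card_eq_three Δ' hΔ'] at h1
      have h2 : (chainPoints w k j).card ≤ (Finset.Icc k j).card := Finset.card_image_le
      rw [Nat.card_Icc] at h2
      omega
    rw [hT0]
    simp [fullTriangulations, hki]
  · have hpos := h.orient_pos_right hik hkj hk hT hU hΔ (x := k + 1) (by omega) (by omega)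
    have hTR : IsTriangulation (chainPoints w k j) (T.filter (· ⊆ chainPoints w k j)) := by
      refine hT.filter_subset (chainPoints_mono hik.le le_rfl) (h.orient_nonpos_right hik)
        (mem_chainPoints_of_le (x := k + 1) (by omega) (by omega))
        (by rw [orient_swap]; linarith) fun Δ' hΔ' => ?_
      rcases h.subset_or_subset_of_mem hik hkj hk hT hU hΔ hΔ' with rfl | h' | h'
      · right
        intro p hp
        simp only [Finset.mem_insert, Finset.mem_singleton] at hp
        rcases hp with rfl | rfl | rfl
        · rw [orient_rotate]; exact hk.le
        · simp
        · simp
      · exact Or.inr fun p hp => h.orient_nonneg_right hkj p (h' hp)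
      · exact Or.inl h'
    rw [mem_fullTriangulations hki]
    refine ⟨hTR, Finset.Subset.antisymm ?_ ?_⟩
    · intro p hp
      obtain ⟨Δ', hΔ', hp'⟩ := mem_usedPoints.1 hp
      exact hTR.vertices_subset Δ' hΔ' hp'
    · intro p hp
      obtain ⟨Δ', hΔ', hp'⟩ := hTR.exists_mem_convexHull (subset_convexHull ℝ _ hp)
      have hpU : p ∈ usedPoints T := by rw [hU]; exact chainPoints_mono hik.le le_rfl hp
      obtain ⟨Δ'', hΔ'', hp''⟩ := mem_usedPoints.1 hpU
      exact mem_usedPoints.2 ⟨Δ', hΔ',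
        hT.mem_of_mem_convexHull (Finset.mem_filter.1 hΔ').1 hΔ'' hp'' hp'⟩

theorem insert_filter_union_filter :
    insert {w i, w k, w j}
      (T.filter (· ⊆ chainPoints w i k) ∪ T.filter (· ⊆ chainPoints w k j)) = T := by
  ext Δ'
  simp only [Finset.mem_insert, Finset.mem_union, Finset.mem_filter]
  constructor
  · rintro (rfl | h' | h')
    · exact hΔ
    · exact h'.1
    · exact h'.1
  · intro hΔ'
    rcases h.subset_or_subset_of_mem hik hkj hk hT hU hΔ hΔ' with h' | h' | h' <;> tauto

end Cut

theorem subset_of_mem_fullTriangulations {a b : ℕ} {Δ : Finset Plane}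
    (hT : T ∈ fullTriangulations w a b) (hΔ : Δ ∈ T) : Δ ⊆ chainPoints w a b := by
  by_cases hab : b = a + 1
  · simp only [fullTriangulations, hab, if_true, Finset.mem_singleton] at hT
    simp [hT] at hΔ
  · exact ((mem_fullTriangulations hab).1 hT).1.vertices_subset Δ hΔ

/-- In a full triangulation of a chain, the closing edge is an edge of some triangle; the empty
triangulation of a single edge contains no triangle at all. -/
theorem exists_isTriangulation_of_mem (h : IsConvexChain w i j) (hij : i < j)
    {Δ : Finset Plane} (hT : T ∈ fullTriangulations w i j) (hΔ : Δ ∈ T) :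
    IsTriangulation (chainPoints w i j) T ∧ ∃ Δ₁ ∈ T, w i ∈ Δ₁ ∧ w j ∈ Δ₁ := by
  by_cases hab : j = i + 1
  · simp only [fullTriangulations, hab, if_true, Finset.mem_singleton] at hT
    simp [hT] at hΔ
  · obtain ⟨h1, h2⟩ := (mem_fullTriangulations hab).1 hT
    obtain ⟨k, -, -, -, hk⟩ := h.exists_base_triangle hij h1 h2
    exact ⟨h1, _, hk, by simp, by simp⟩

theorem usedPoints_of_mem_fullTriangulations {p : Plane}
    (hT : T ∈ fullTriangulations w i j) (hp : p ∈ chainPoints w i j) :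
    p = w i ∨ p = w j ∨ p ∈ usedPoints T := by
  by_cases hab : j = i + 1
  · obtain ⟨x, hx, hx', rfl⟩ := mem_chainPoints.1 hp
    have : x = i ∨ x = j := by omega
    rcases this with rfl | rfl <;> simp
  · rw [((mem_fullTriangulations hab).1 hT).2]
    exact Or.inr (Or.inr hp)

/-- The polygon is covered by its base triangle and the two polygons that it cuts off. -/
theorem mem_convexHull_cases (h : IsConvexChain w i j) (hik : i < k) (hkj : k < j)
    (hk : 0 < orient (w i) (w k) (w j)) {p : Plane}
    (hp : p ∈ convexHull ℝ (chainPoints w i j : Set Plane)) :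
    p ∈ convexHull ℝ ({w i, w k, w j} : Set Plane) ∨
    (orient (w i) (w k) p < 0 ∧ p ∈ convexHull ℝ (chainPoints w i k : Set Plane)) ∨
    (orient (w k) (w j) p < 0 ∧ p ∈ convexHull ℝ (chainPoints w k j : Set Plane)) := by
  have hunion : (chainPoints w i j : Set Plane) =
      (chainPoints w i k : Set Plane) ∪ (chainPoints w k j : Set Plane) := by
    ext q
    simp only [Finset.mem_coe, Set.mem_union, mem_chainPoints]
    constructor
    · rintro ⟨x, hx, hx', rfl⟩
      rcases le_total x k with hxk | hxk
      · exact Or.inl ⟨x, hx, hxk, rfl⟩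
      · exact Or.inr ⟨x, hxk, hx', rfl⟩
    · rintro (⟨x, hx, hx', rfl⟩ | ⟨x, hx, hx', rfl⟩)
      · exact ⟨x, hx, by omega, rfl⟩
      · exact ⟨x, by omega, hx', rfl⟩
  have hki : w k ∈ chainPoints w i k := mem_chainPoints_of_le hik.le le_rfl
  have hii : w i ∈ chainPoints w i k := mem_chainPoints_of_le le_rfl hik.le
  have hkk : w k ∈ chainPoints w k j := mem_chainPoints_of_le le_rfl hkj.le
  have hjj : w j ∈ chainPoints w k j := mem_chainPoints_of_le hkj.le le_rfl
  -- `orient` is affine in each argument, so the chain condition passes to points of the hulls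
  have hA : ∀ c, (∀ x ∈ chainPoints w i k, ∀ y ∈ chainPoints w k j, 0 ≤ orient c x y) →
      ∀ a ∈ convexHull ℝ (chainPoints w i k : Set Plane),
      ∀ b ∈ convexHull ℝ (chainPoints w k j : Set Plane), 0 ≤ orient c a b := by
    intro c hc a ha b hb
    refine orient_nonneg_of_mem_convexHull (fun y hy => ?_) hb
    rw [orient_rotate]
    refine orient_nonneg_of_mem_convexHull (fun x hx => ?_) ha
    rw [← orient_rotate]
    exact hc x hx y hy
  have hi : ∀ a ∈ convexHull ℝ (chainPoints w i k : Set Plane),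
      ∀ b ∈ convexHull ℝ (chainPoints w k j : Set Plane), 0 ≤ orient (w i) a b := by
    apply hA
    intro x hx y hy
    obtain ⟨x, hx1, hx2, rfl⟩ := mem_chainPoints.1 hx
    obtain ⟨y, hy1, hy2, rfl⟩ := mem_chainPoints.1 hy
    exact h.orient_nonneg_of_le le_rfl hx1 (by omega) hy2
  have hkab : ∀ a ∈ convexHull ℝ (chainPoints w i k : Set Plane),
      ∀ b ∈ convexHull ℝ (chainPoints w k j : Set Plane), 0 ≤ orient a (w k) b := by
    intro a ha b hb
    refine orient_nonneg_of_mem_convexHull (fun y hy => ?_) hb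
    rw [orient_rotate' a (w k) y]
    refine orient_nonneg_of_mem_convexHull (fun x hx => ?_) ha
    obtain ⟨x, hx1, hx2, rfl⟩ := mem_chainPoints.1 hx
    obtain ⟨y, hy1, hy2, rfl⟩ := mem_chainPoints.1 hy
    rw [orient_rotate]
    exact h.orient_nonneg_of_le hx1 hx2 hy1 hy2
  have hj : ∀ a ∈ convexHull ℝ (chainPoints w i k : Set Plane),
      ∀ b ∈ convexHull ℝ (chainPoints w k j : Set Plane), 0 ≤ orient (w j) a b := by
    apply hA
    intro x hx y hy
    obtain ⟨x, hx1, hx2, rfl⟩ := mem_chainPoints.1 hx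
    obtain ⟨y, hy1, hy2, rfl⟩ := mem_chainPoints.1 hy
    rw [← orient_rotate]
    exact h.orient_nonneg_of_le hx1 (by omega) hy2 le_rfl
  rcases lt_or_ge (orient (w i) (w k) p) 0 with h1 | h1
  · right; left
    refine ⟨h1, mem_convexHull_of_orient_neg (Q := chainPoints w k j) hii hki ⟨_, hkk⟩
      (h.orient_nonpos_left hkj) (h.orient_nonneg_left hik) ?_ (hunion ▸ hp) h1⟩
    intro a ha b hb ha0
    refine exists_mem_segment_inter (hkab a ha b hb) (hi a ha b hb)
      (orient_nonneg_of_mem_convexHull (h.orient_nonneg_left hik) hb)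
      (by rw [orient_swap]; linarith) ?_
    rw [orient_add_orient, orient_swap (w i) (w k) a]
    linarith [orient_nonneg_of_mem_convexHull (h.orient_nonneg_left hik) hb]
  rcases lt_or_ge (orient (w k) (w j) p) 0 with h2 | h2
  · right; right
    refine ⟨h2, mem_convexHull_of_orient_neg (Q := chainPoints w i k) hkk hjj ⟨_, hii⟩
      (h.orient_nonpos_right hik) (h.orient_nonneg_right hkj) ?_
      (by rw [Set.union_comm]; exact hunion ▸ hp) h2⟩
    intro a ha b hb ha0
    obtain ⟨z, hz, hz'⟩ := exists_mem_segment_inter (a := w k) (b := a) (c := w j) (d := b)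
      (by rw [orient_rotate]; rw [orient_rotate]; exact hj b hb a ha)
      (by rw [← orient_rotate'] ; exact hkab b hb a ha)
      (orient_nonneg_of_mem_convexHull (h.orient_nonneg_right hkj) hb)
      (by rw [orient_swap]; linarith)
      (by
        rw [orient_add_orient, orient_swap (w k) (w j) a]
        linarith [orient_nonneg_of_mem_convexHull (h.orient_nonneg_right hkj) hb])
    exact ⟨z, hz, hz'⟩
  · left
    refine mem_convexHull_triangle hk h1 h2 (orient_nonneg_of_mem_convexHull (fun q hq => ?_) hp)
    obtain ⟨x, hx1, hx2, rfl⟩ := mem_chainPoints.1 hq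
    rw [← orient_rotate]
    exact h.orient_nonneg_of_le le_rfl hx1 hx2 le_rfl

/-- Gluing full triangulations of the two cut-off polygons to a base triangle gives a
triangulation. -/
theorem isTriangulation_glue (h : IsConvexChain w i j) (hik : i < k) (hkj : k < j)
    (hk : 0 < orient (w i) (w k) (w j)) (hT₁ : T₁ ∈ fullTriangulations w i k)
    (hT₂ : T₂ ∈ fullTriangulations w k j) :
    IsTriangulation (chainPoints w i j) (insert {w i, w k, w j} (T₁ ∪ T₂)) := by
  have hL : IsConvexChain w i k := h.mono le_rfl hkj.le
  have hR : IsConvexChain w k j := h.mono hik.le le_rfl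
  have htri₁ : ∀ Δ ∈ T₁, IsTriangulation (chainPoints w i k) T₁ :=
    fun Δ hΔ => (hL.exists_isTriangulation_of_mem hik hT₁ hΔ).1
  have htri₂ : ∀ Δ ∈ T₂, IsTriangulation (chainPoints w k j) T₂ :=
    fun Δ hΔ => (hR.exists_isTriangulation_of_mem hkj hT₂ hΔ).1
  have hcoe : ((({w i, w k, w j} : Finset Plane)) : Set Plane) = {w i, w k, w j} := by simp
  refine ⟨?_, ?_, ?_, ?_, ?_⟩
  · intro Δ hΔ
    simp only [Finset.mem_insert, Finset.mem_union] at hΔ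
    rcases hΔ with rfl | hΔ | hΔ
    · simp only [Finset.insert_subset_iff, Finset.singleton_subset_iff]
      exact ⟨mem_chainPoints_of_le le_rfl (by omega), mem_chainPoints_of_le hik.le hkj.le,
        mem_chainPoints_of_le (by omega) le_rfl⟩
    · exact ((htri₁ Δ hΔ).vertices_subset Δ hΔ).trans (chainPoints_mono le_rfl hkj.le)
    · exact ((htri₂ Δ hΔ).vertices_subset Δ hΔ).trans (chainPoints_mono hik.le le_rfl)
  · intro Δ hΔ
    simp only [Finset.mem_insert, Finset.mem_union] at hΔ
    rcases hΔ with rfl | hΔ | hΔ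
    · exact card_triple_of_orient_pos hk
    · exact (htri₁ Δ hΔ).card_eq_three Δ hΔ
    · exact (htri₂ Δ hΔ).card_eq_three Δ hΔ
  · intro Δ hΔ
    simp only [Finset.mem_insert, Finset.mem_union] at hΔ
    rcases hΔ with rfl | hΔ | hΔ
    · exact affineIndependent_of_orient_pos hk
    · exact (htri₁ Δ hΔ).nondegenerate Δ hΔ
    · exact (htri₂ Δ hΔ).nondegenerate Δ hΔ
  · apply Set.Subset.antisymm
    · intro p hp
      simp only [Set.mem_iUnion, exists_prop, Finset.mem_insert, Finset.mem_union]
      rcases h.mem_convexHull_cases hik hkj hk hp with h' | ⟨h0, h'⟩ | ⟨h0, h'⟩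
      · exact ⟨_, Or.inl rfl, by rwa [hcoe]⟩
      · have hki : k ≠ i + 1 := by
          rintro rfl
          have : orient (w i) (w (i + 1)) p = 0 := by
            refine le_antisymm h0.le (orient_nonneg_of_mem_convexHull (fun q hq => ?_) h')
            obtain ⟨x, hx, hx', rfl⟩ := mem_chainPoints.1 hq
            have : x = i ∨ x = i + 1 := by omega
            rcases this with rfl | rfl <;> simp
          linarith
        obtain ⟨Δ, hΔ, hpΔ⟩ := ((mem_fullTriangulations hki).1 hT₁).1.exists_mem_convexHull h'
        exact ⟨Δ, Or.inr (Or.inl hΔ), hpΔ⟩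
      · have hki : j ≠ k + 1 := by
          rintro rfl
          have : orient (w k) (w (k + 1)) p = 0 := by
            refine le_antisymm h0.le (orient_nonneg_of_mem_convexHull (fun q hq => ?_) h')
            obtain ⟨x, hx, hx', rfl⟩ := mem_chainPoints.1 hq
            have : x = k ∨ x = k + 1 := by omega
            rcases this with rfl | rfl <;> simp
          linarith
        obtain ⟨Δ, hΔ, hpΔ⟩ := ((mem_fullTriangulations hki).1 hT₂).1.exists_mem_convexHull h'
        exact ⟨Δ, Or.inr (Or.inr hΔ), hpΔ⟩
    · refine Set.iUnion₂_subset fun Δ hΔ => convexHull_mono (Finset.coe_subset.2 ?_)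
      simp only [Finset.mem_insert, Finset.mem_union] at hΔ
      rcases hΔ with rfl | hΔ | hΔ
      · simp only [Finset.insert_subset_iff, Finset.singleton_subset_iff]
        exact ⟨mem_chainPoints_of_le le_rfl (by omega), mem_chainPoints_of_le hik.le hkj.le,
          mem_chainPoints_of_le (by omega) le_rfl⟩
      · exact ((htri₁ Δ hΔ).vertices_subset Δ hΔ).trans (chainPoints_mono le_rfl hkj.le)
      · exact ((htri₂ Δ hΔ).vertices_subset Δ hΔ).trans (chainPoints_mono hik.le le_rfl)
  · -- the three mixed cases, up to symmetry
    have h01 : ∀ Δ ∈ T₁, ∀ p, p ∈ convexHull ℝ ((({w i, w k, w j} : Finset Plane)) : Set Plane) →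
        p ∈ convexHull ℝ (Δ : Set Plane) →
        p ∈ convexHull ℝ (((({w i, w k, w j} : Finset Plane)) : Set Plane) ∩ Δ) := by
      intro Δ hΔ p hp hp'
      obtain ⟨ht, Δ₁, hΔ₁, h1, h2⟩ := hL.exists_isTriangulation_of_mem hik hT₁ hΔ
      exact ht.mem_convexHull_inter_of_edge (h.orient_nonpos_left hkj) hk
        (by intro q; simp) hΔ₁ h1 h2 hΔ hp hp'
    have h02 : ∀ Δ ∈ T₂, ∀ p, p ∈ convexHull ℝ ((({w i, w k, w j} : Finset Plane)) : Set Plane) →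
        p ∈ convexHull ℝ (Δ : Set Plane) →
        p ∈ convexHull ℝ (((({w i, w k, w j} : Finset Plane)) : Set Plane) ∩ Δ) := by
      intro Δ hΔ p hp hp'
      obtain ⟨ht, Δ₁, hΔ₁, h1, h2⟩ := hR.exists_isTriangulation_of_mem hkj hT₂ hΔ
      exact ht.mem_convexHull_inter_of_edge (c := w i) (h.orient_nonpos_right hik)
        (by rwa [orient_rotate]) (by intro q; simp; tauto) hΔ₁ h1 h2 hΔ hp hp'
    have h12 : ∀ Δ ∈ T₁, ∀ Δ' ∈ T₂, ∀ p, p ∈ convexHull ℝ (Δ : Set Plane) →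
        p ∈ convexHull ℝ (Δ' : Set Plane) → p ∈ convexHull ℝ ((Δ : Set Plane) ∩ Δ') := by
      intro Δ hΔ Δ' hΔ' p hp hp'
      have ht₁ := htri₁ Δ hΔ
      have ht₂ := htri₂ Δ' hΔ'
      have hs₁ := ht₁.vertices_subset Δ hΔ
      have hs₂ := ht₂.vertices_subset Δ' hΔ'
      have e1 : orient (w i) (w k) p = 0 := le_antisymm
        (orient_nonpos_of_mem_convexHull
          (fun q hq => h.orient_nonpos_left hkj q (hs₁ hq)) hp)
        (orient_nonneg_of_mem_convexHull
          (fun q hq => h.orient_nonneg_left hik q (hs₂ hq)) hp')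
      have e2 : orient (w k) (w j) p = 0 := le_antisymm
        (orient_nonpos_of_mem_convexHull
          (fun q hq => h.orient_nonpos_right hik q (hs₂ hq)) hp')
        (orient_nonneg_of_mem_convexHull
          (fun q hq => h.orient_nonneg_right hkj q (hs₁ hq)) hp)
      -- the two edges at the apex only share the apex
      obtain ⟨r, hr⟩ := exists_smul_of_orient_eq_zero
        (h.ne le_rfl (by omega) hik.le hkj.le hik.ne) e1
      have hr1 : (1 - r) * orient (w i) (w k) (w j) = 0 := by
        rw [← e2, hr]
        simp only [orient, PiLp.add_apply, PiLp.smul_apply, PiLp.sub_apply, smul_eq_mul]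
        ring
      have hr1' : r = 1 := by
        rcases mul_eq_zero.1 hr1 with h' | h'
        · linarith
        · exact absurd h' hk.ne'
      have hpk : p = w k := by rw [hr, hr1']; module
      have hp1 : p ∈ Δ := by
        have hki : k ≠ i + 1 := by
          rintro rfl
          simp only [fullTriangulations, if_true, Finset.mem_singleton] at hT₁
          simp [hT₁] at hΔ
        have : p ∈ usedPoints T₁ := by
          rw [((mem_fullTriangulations hki).1 hT₁).2, hpk]
          exact mem_chainPoints_of_le hik.le le_rfl
        obtain ⟨Δ'', hΔ'', hp''⟩ := mem_usedPoints.1 this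
        exact ht₁.mem_of_mem_convexHull hΔ hΔ'' hp'' hp
      have hp2 : p ∈ Δ' := by
        have hki : j ≠ k + 1 := by
          rintro rfl
          simp only [fullTriangulations, if_true, Finset.mem_singleton] at hT₂
          simp [hT₂] at hΔ'
        have : p ∈ usedPoints T₂ := by
          rw [((mem_fullTriangulations hki).1 hT₂).2, hpk]
          exact mem_chainPoints_of_le le_rfl hkj.le
        obtain ⟨Δ'', hΔ'', hp''⟩ := mem_usedPoints.1 this
        exact ht₂.mem_of_mem_convexHull hΔ' hΔ'' hp'' hp'
      exact subset_convexHull ℝ _ ⟨hp1, hp2⟩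
    intro Δ hΔ Δ' hΔ' hne
    refine Set.Subset.antisymm ?_ (Set.subset_inter (convexHull_mono Set.inter_subset_left)
      (convexHull_mono Set.inter_subset_right))
    rintro p ⟨hp, hp'⟩
    simp only [Finset.mem_insert, Finset.mem_union] at hΔ hΔ'
    rcases hΔ with rfl | hΔ | hΔ <;> rcases hΔ' with rfl | hΔ' | hΔ'
    · exact absurd rfl hne
    · exact h01 _ hΔ' p hp hp'
    · exact h02 _ hΔ' p hp hp'
    · rw [Set.inter_comm]; exact h01 _ hΔ p hp' hp
    · rw [← (htri₁ Δ hΔ).face_to_face Δ hΔ Δ' hΔ' hne]; exact ⟨hp, hp'⟩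
    · exact h12 _ hΔ _ hΔ' p hp hp'
    · rw [Set.inter_comm]; exact h02 _ hΔ p hp' hp
    · rw [Set.inter_comm]; exact h12 _ hΔ' _ hΔ p hp' hp
    · rw [← (htri₂ Δ hΔ).face_to_face Δ hΔ Δ' hΔ' hne]; exact ⟨hp, hp'⟩

theorem glue_mem_fullTriangulations (h : IsConvexChain w i j) (hik : i < k) (hkj : k < j)
    (hk : 0 < orient (w i) (w k) (w j)) (hT₁ : T₁ ∈ fullTriangulations w i k)
    (hT₂ : T₂ ∈ fullTriangulations w k j) :
    insert {w i, w k, w j} (T₁ ∪ T₂) ∈ fullTriangulations w i j := by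
  rw [mem_fullTriangulations (by omega)]
  have hT := h.isTriangulation_glue hik hkj hk hT₁ hT₂
  refine ⟨hT, Finset.Subset.antisymm ?_ ?_⟩
  · intro p hp
    obtain ⟨Δ, hΔ, hp'⟩ := mem_usedPoints.1 hp
    exact hT.vertices_subset Δ hΔ hp'
  · intro p hp
    have hbase : ∀ q ∈ ({w i, w k, w j} : Finset Plane),
        q ∈ usedPoints (insert {w i, w k, w j} (T₁ ∪ T₂)) :=
      fun q hq => mem_usedPoints.2 ⟨_, Finset.mem_insert_self _ _, hq⟩
    have h1 : ∀ q ∈ usedPoints T₁, q ∈ usedPoints (insert {w i, w k, w j} (T₁ ∪ T₂)) := by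
      intro q hq
      obtain ⟨Δ, hΔ, hq'⟩ := mem_usedPoints.1 hq
      exact mem_usedPoints.2 ⟨Δ, by simp [hΔ], hq'⟩
    have h2 : ∀ q ∈ usedPoints T₂, q ∈ usedPoints (insert {w i, w k, w j} (T₁ ∪ T₂)) := by
      intro q hq
      obtain ⟨Δ, hΔ, hq'⟩ := mem_usedPoints.1 hq
      exact mem_usedPoints.2 ⟨Δ, by simp [hΔ], hq'⟩
    obtain ⟨x, hx, hx', rfl⟩ := mem_chainPoints.1 hp
    rcases le_total x k with hxk | hxk
    · rcases usedPoints_of_mem_fullTriangulations hT₁ (mem_chainPoints_of_le hx hxk) with h' | h' | h'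
      · exact hbase _ (by simp [h'])
      · exact hbase _ (by simp [h'])
      · exact h1 _ h'
    · rcases usedPoints_of_mem_fullTriangulations hT₂ (mem_chainPoints_of_le hxk hx') with h' | h' | h'
      · exact hbase _ (by simp [h'])
      · exact hbase _ (by simp [h'])
      · exact h2 _ h'

/-- A triangle has too many vertices to fit on both sides of the apex. -/
theorem not_subset_of_subset (h : IsConvexChain w i j) (hik : i < k) (hkj : k < j)
    {Δ : Finset Plane} (hcard : Δ.card = 3) (h1 : Δ ⊆ chainPoints w i k)
    (h2 : Δ ⊆ chainPoints w k j) : False := by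
  have : Δ ⊆ {w k} := by
    intro p hp
    obtain ⟨x, hx, hx', rfl⟩ := mem_chainPoints.1 (h1 hp)
    have := ((h.mem_chainPoints_iff hik.le le_rfl hx (by omega)).1 (h2 hp)).1
    obtain rfl : x = k := by omega
    simp
  have := Finset.card_le_card this
  rw [hcard, Finset.card_singleton] at this
  omega

/-- The full triangulations with a given base triangle correspond to pairs of full
triangulations of the two polygons cut off by it. -/
theorem card_filter_mem (h : IsConvexChain w i j) (hik : i < k) (hkj : k < j)
    (hk : 0 < orient (w i) (w k) (w j)) :
    ((fullTriangulations w i j).filter ({w i, w k, w j} ∈ ·)).card =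
      (fullTriangulations w i k).card * (fullTriangulations w k j).card := by
  rw [← Finset.card_product]
  refine Finset.card_nbij'
    (fun T => (T.filter (· ⊆ chainPoints w i k), T.filter (· ⊆ chainPoints w k j)))
    (fun p => insert {w i, w k, w j} (p.1 ∪ p.2)) ?_ ?_ ?_ ?_
  · intro T hT
    simp only [Finset.coe_filter, Set.mem_ofPred_eq] at hT
    obtain ⟨hT, hΔ⟩ := hT
    obtain ⟨hT, hU⟩ := (mem_fullTriangulations (by omega)).1 hT
    simp only [Finset.coe_product, Set.mem_prod, Finset.mem_coe]
    exact ⟨h.filter_left_mem hik hkj hk hT hU hΔ, h.filter_right_mem hik hkj hk hT hU hΔ⟩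
  · rintro ⟨T₁, T₂⟩ hT
    simp only [Finset.coe_product, Set.mem_prod, Finset.mem_coe] at hT
    simp only [Finset.coe_filter, Set.mem_ofPred_eq]
    exact ⟨h.glue_mem_fullTriangulations hik hkj hk hT.1 hT.2, Finset.mem_insert_self _ _⟩
  · intro T hT
    simp only [Finset.coe_filter, Set.mem_ofPred_eq] at hT
    obtain ⟨hT, hΔ⟩ := hT
    obtain ⟨hT, hU⟩ := (mem_fullTriangulations (by omega)).1 hT
    exact h.insert_filter_union_filter hik hkj hk hT hU hΔ
  · rintro ⟨T₁, T₂⟩ hT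
    simp only [Finset.coe_product, Set.mem_prod, Finset.mem_coe] at hT
    obtain ⟨hT₁, hT₂⟩ := hT
    have hglue := h.isTriangulation_glue hik hkj hk hT₁ hT₂
    simp only [Prod.mk.injEq]
    constructor
    · ext Δ
      simp only [Finset.mem_filter, Finset.mem_insert, Finset.mem_union]
      constructor
      · rintro ⟨rfl | h' | h', hsub⟩
        · have := (h.mem_chainPoints_iff le_rfl hkj.le (by omega) le_rfl).1
            (hsub (by simp : w j ∈ _))
          omega
        · exact h'
        · exact (h.not_subset_of_subset hik hkj (hglue.card_eq_three Δ (by simp [h'])) hsub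
            (subset_of_mem_fullTriangulations hT₂ h')).elim
      · exact fun h' => ⟨Or.inr (Or.inl h'), subset_of_mem_fullTriangulations hT₁ h'⟩
    · ext Δ
      simp only [Finset.mem_filter, Finset.mem_insert, Finset.mem_union]
      constructor
      · rintro ⟨rfl | h' | h', hsub⟩
        · have := (h.mem_chainPoints_iff hik.le le_rfl le_rfl (by omega)).1
            (hsub (by simp : w i ∈ _))
          omega
        · exact (h.not_subset_of_subset hik hkj (hglue.card_eq_three Δ (by simp [h']))
            (subset_of_mem_fullTriangulations hT₁ h') hsub).elim
        · exact h'
      · exact fun h' => ⟨Or.inr (Or.inr h'), subset_of_mem_fullTriangulations hT₂ h'⟩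

theorem apex_unique (h : IsConvexChain w i j) {S : Finset Plane} (hT : IsTriangulation S T)
    {k k' : ℕ} (hik : i < k) (hkk : k < k') (hkj : k' < j) (hk' : 0 < orient (w i) (w k') (w j))
    (h1 : {w i, w k, w j} ∈ T) (h2 : {w i, w k', w j} ∈ T) : False := by
  refine h.not_crossing hT h2 h1 le_rfl hik hkk hkj le_rfl ?_ (by simp) (by simp) (by simp)
    (by simp)
  rw [orient_add_orient]
  linarith [h.orient_nonneg_of_le (x := i) (y := k) (z := k') le_rfl hik.le hkk.le hkj.le]

open Classical in
/-- The recursion for the number of full triangulations: sum over the apex of the base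
triangle. -/
theorem card_fullTriangulations (h : IsConvexChain w i j) (hij : i + 2 ≤ j) :
    (fullTriangulations w i j).card =
      ∑ k ∈ (Finset.Ioo i j).filter (fun k => 0 < orient (w i) (w k) (w j)),
        (fullTriangulations w i k).card * (fullTriangulations w k j).card := by
  have hun : fullTriangulations w i j =
      ((Finset.Ioo i j).filter (fun k => 0 < orient (w i) (w k) (w j))).biUnion
        (fun k => (fullTriangulations w i j).filter ({w i, w k, w j} ∈ ·)) := by
    ext T
    simp only [Finset.mem_biUnion, Finset.mem_filter, Finset.mem_Ioo]
    constructor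
    · intro hT
      obtain ⟨hT', hU⟩ := (mem_fullTriangulations (by omega)).1 hT
      obtain ⟨k, h1, h2, h3, h4⟩ := h.exists_base_triangle (by omega) hT' hU
      exact ⟨k, ⟨⟨h1, h2⟩, h3⟩, hT, h4⟩
    · rintro ⟨k, -, hT, -⟩
      exact hT
  rw [hun, Finset.card_biUnion]
  · refine Finset.sum_congr rfl fun k hk => ?_
    simp only [Finset.mem_filter, Finset.mem_Ioo] at hk
    convert h.card_filter_mem hk.1.1 hk.1.2 hk.2
  · intro k hk k' hk' hne
    simp only [Finset.coe_filter, Finset.mem_Ioo, Set.mem_ofPred_eq] at hk hk'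
    rw [Function.onFun, Finset.disjoint_left]
    intro T hT hT'
    simp only [Finset.mem_filter] at hT hT'
    have htri := ((mem_fullTriangulations (by omega)).1 hT.1).1
    rcases lt_or_gt_of_ne hne with hlt | hlt
    · exact h.apex_unique htri hk.1.1 hlt hk'.1.2 hk'.2 hT.2 hT'.2
    · exact h.apex_unique htri hk'.1.1 hlt hk.1.2 hk.2 hT'.2 hT.2

end IsConvexChain

/-! ### Edge polynomials, continuants and Catalan numbers -/

/-- The pairing with `t² G_C(t)` as a linear functional: it sends `t ^ (k + 2)` to the `k`-th
Catalan number and kills `1` and `t`. -/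
noncomputable def catalanPairing (R : Type*) [CommRing R] : R[X] →ₗ[R] R where
  toFun p := pairing p (PowerSeries.X ^ 2 * catalanGenerating R)
  map_add' p q := by
    simp only [pairing]
    exact sum_add_index p q _ (by simp) (by intros; ring)
  map_smul' r p := by
    simp only [pairing, RingHom.id_apply, smul_eq_mul]
    rw [sum_smul_index p r _ (by simp), sum_def, sum_def, Finset.mul_sum]
    simp only [mul_assoc]

theorem catalanPairing_apply {R : Type*} [CommRing R] (p : R[X]) :
    catalanPairing R p = pairing p (PowerSeries.X ^ 2 * catalanGenerating R) := rfl

theorem catalanPairing_monomial {R : Type*} [CommRing R] (k : ℕ) (a : R) :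
    catalanPairing R (monomial k a) =
      a * PowerSeries.coeff k (PowerSeries.X ^ 2 * catalanGenerating R) := by
  rw [catalanPairing_apply, pairing, sum_monomial_index _ _ (by simp)]

theorem coeff_catalan {R : Type*} [CommRing R] (k : ℕ) :
    PowerSeries.coeff (k + 2) (PowerSeries.X ^ 2 * catalanGenerating R) = (catalan k : R) := by
  rw [PowerSeries.coeff_X_pow_mul]
  simp [catalanGenerating]

theorem catalanPairing_X_pow (k : ℕ) : catalanPairing ℤ (X ^ (k + 2)) = catalan k := by
  rw [X_pow_eq_monomial, catalanPairing_monomial, coeff_catalan, one_mul]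

/-- The pairing commutes with the extension of scalars from `ℤ` to `ℤ[s]`. -/
theorem catalanPairing_map (p : ℤ[X]) :
    catalanPairing ℤ[X] (p.map (C : ℤ →+* ℤ[X])) = C (catalanPairing ℤ p) := by
  induction p using Polynomial.induction_on' with
  | add p q hp hq => simp only [Polynomial.map_add, map_add, hp, hq]
  | monomial k a =>
    rw [map_monomial, catalanPairing_monomial, catalanPairing_monomial, C_mul]
    congr 1
    rw [PowerSeries.coeff_X_pow_mul', PowerSeries.coeff_X_pow_mul']
    split_ifs <;> simp [catalanGenerating]

theorem sum_catalan_mul_catalan {q : ℕ} (hq : 1 ≤ q) :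
    ∑ r ∈ Finset.range q, (catalan r : ℤ) * catalan (q - 1 - r) = catalan q := by
  obtain ⟨q, rfl⟩ := Nat.exists_eq_add_of_le' hq
  rw [catalan_succ, Finset.sum_range]
  push_cast
  rfl

/-- The maximal edge polynomial as a sum over the exponent of `t`. -/
theorem maxEdgePolynomial_eq (m : ℕ) : maxEdgePolynomial m =
    ∑ a ∈ Finset.range (m + 1), (-1) ^ (m - a) * (a.choose (m - a) : ℤ[X]) * X ^ a := by
  rw [maxEdgePolynomial, ← Finset.sum_range_reflect _ (m + 1)]
  have hsub : Finset.range (m / 2 + 1) ⊆ Finset.range (m + 1) :=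
    Finset.range_subset_range.2 (by omega)
  rw [Finset.sum_subset hsub]
  · refine Finset.sum_congr rfl fun k hk => ?_
    rw [Finset.mem_range] at hk
    rw [show m + 1 - 1 - k = m - k by omega, show m - (m - k) = k by omega]
  · intro k hk hk'
    rw [Finset.mem_range] at hk hk'
    rw [Nat.choose_eq_zero_of_lt (by omega)]
    simp

theorem maxEdgePolynomial_zero : maxEdgePolynomial 0 = 1 := by
  simp [maxEdgePolynomial]

theorem maxEdgePolynomial_one : maxEdgePolynomial 1 = X := by
  simp [maxEdgePolynomial]

theorem maxEdgePolynomial_add_two (m : ℕ) :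
    maxEdgePolynomial (m + 2) = X * (maxEdgePolynomial (m + 1) - maxEdgePolynomial m) := by
  rw [maxEdgePolynomial_eq, Finset.sum_range_succ', maxEdgePolynomial_eq (m + 1),
    maxEdgePolynomial_eq m, mul_sub, Finset.sum_range_succ, Finset.sum_range_succ _ (m + 1),
    mul_add, Finset.mul_sum, Finset.mul_sum, add_sub_right_comm, ← Finset.sum_sub_distrib]
  rw [show m + 2 - 0 = m + 2 by rfl, Nat.choose_eq_zero_of_lt (show 0 < m + 2 by omega)]
  simp only [Nat.cast_zero, mul_zero, zero_mul, add_zero]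
  congr 1
  · refine Finset.sum_congr rfl fun b hb => ?_
    rw [Finset.mem_range] at hb
    rw [show m + 2 - (b + 1) = (m - b) + 1 by omega, show m + 1 - b = (m - b) + 1 by omega,
      Nat.choose_succ_succ]
    push_cast
    ring
  · simp only [show m + 2 - (m + 1 + 1) = 0 by omega, Nat.sub_self, Nat.choose_zero_right]
    ring

/-- The continuant of the chain of `n` edges that starts at the `i`-th vertex. The weight `e k` is
`0` if the `k`-th vertex is a corner and `1` if the chain is straight there. The continuant is the
product of the maximal edge polynomials of the straight parts of the chain. -/
noncomputable def continuant (e : ℕ → ℤ) (i : ℕ) : ℕ → ℤ[X]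
  | 0 => 1
  | 1 => X
  | n + 2 => X * continuant e i (n + 1) - C (e (i + n + 1)) * (X * continuant e i n)

/-- `t ^ (q + 1)` times the continuant, paired with `t² G_C(t)`: the number of triangulations of
the chain, closed by a strictly convex chain of `q + 1` edges. -/
noncomputable def chainNumber (e : ℕ → ℤ) (i n q : ℕ) : ℤ :=
  catalanPairing ℤ (X ^ (q + 1) * continuant e i n)

theorem chainNumber_zero (e : ℕ → ℤ) (i q : ℕ) : chainNumber e i 0 (q + 1) = catalan q := by
  rw [chainNumber, continuant, mul_one, catalanPairing_X_pow]

theorem chainNumber_one (e : ℕ → ℤ) (i q : ℕ) : chainNumber e i 1 q = catalan q := by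
  rw [chainNumber, continuant, ← pow_succ, catalanPairing_X_pow]

theorem chainNumber_add_two (e : ℕ → ℤ) (i n q : ℕ) : chainNumber e i (n + 2) q =
    chainNumber e i (n + 1) (q + 1) - e (i + n + 1) * chainNumber e i n (q + 1) := by
  simp only [chainNumber, continuant]
  rw [← smul_eq_mul (e (i + n + 1)), ← map_smul, ← map_sub]
  congr 1
  rw [smul_eq_C_mul]
  ring

/-- The Catalan recursion for chain numbers, over the apex of the triangle on the last edge of the
closing chain: in the first sum the apex is an inner vertex of the given chain, in the second sum it
is the end point of that chain or an inner vertex of the closing chain. The recursion can fail only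
for `q = 0` and fewer than three edges. -/
theorem chainNumber_succ (e : ℕ → ℤ) (i m q : ℕ) (h : 1 ≤ q ∨ 2 ≤ m) :
    chainNumber e i (m + 1) q =
      ∑ k ∈ Finset.range m, chainNumber e i (k + 1) 0 * chainNumber e (i + k + 1) (m - k) q +
      ∑ r ∈ Finset.range q, chainNumber e i (m + 1) r * catalan (q - 1 - r) := by
  induction m using Nat.strong_induction_on generalizing q with
  | _ m ih =>
  rcases m with _ | _ | m
  · have hq : 1 ≤ q := by omega
    simp only [zero_add, chainNumber_one, Finset.range_zero, Finset.sum_empty]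
    rw [sum_catalan_mul_catalan hq]
  · have hq : 1 ≤ q := by omega
    have h1 := sum_catalan_mul_catalan (q := q + 1) (by omega)
    have h2 := sum_catalan_mul_catalan hq
    rw [Finset.sum_range_succ'] at h1
    simp only [zero_add, Finset.sum_range_one, chainNumber_add_two e i 0, chainNumber_one,
      chainNumber_zero, sub_mul, Finset.sum_sub_distrib, mul_assoc, ← Finset.mul_sum,
      Nat.sub_zero]
    have h3 : ∑ r ∈ Finset.range q, (catalan (r + 1) : ℤ) * catalan (q + 1 - 1 - (r + 1)) =
        ∑ r ∈ Finset.range q, (catalan (r + 1) : ℤ) * catalan (q - 1 - r) :=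
      Finset.sum_congr rfl fun r _ => by rw [show q + 1 - 1 - (r + 1) = q - 1 - r by omega]
    rw [h3] at h1
    simp only [catalan_zero, Nat.cast_one, one_mul, Nat.add_sub_cancel, Nat.sub_zero] at h1 ⊢
    rw [h2, ← h1]
    ring
  · have ih1 := ih (m + 1) (by omega) (q + 1) (Or.inl (by omega))
    have ih2 := ih m (by omega) (q + 1) (Or.inl (by omega))
    rw [Finset.sum_range_succ' _ q] at ih1 ih2
    have hC : ∀ n, ∑ r ∈ Finset.range q, chainNumber e i n (r + 1) *
          (catalan (q + 1 - 1 - (r + 1)) : ℤ) =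
        ∑ r ∈ Finset.range q, chainNumber e i n (r + 1) * (catalan (q - 1 - r) : ℤ) := fun n =>
      Finset.sum_congr rfl fun r _ => by rw [show q + 1 - 1 - (r + 1) = q - 1 - r by omega]
    rw [hC] at ih1 ih2
    have hsum1 : ∑ k ∈ Finset.range (m + 2),
          chainNumber e i (k + 1) 0 * chainNumber e (i + k + 1) (m + 2 - k) q =
        ∑ k ∈ Finset.range (m + 1),
          chainNumber e i (k + 1) 0 * chainNumber e (i + k + 1) (m + 1 - k) (q + 1) -
        e (i + (m + 1) + 1) * (∑ k ∈ Finset.range m,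
          chainNumber e i (k + 1) 0 * chainNumber e (i + k + 1) (m - k) (q + 1) +
          chainNumber e i (m + 1) 0 * catalan q) +
        chainNumber e i (m + 2) 0 * catalan q := by
      rw [Finset.sum_range_succ _ (m + 1), show m + 2 - (m + 1) = 1 by omega, chainNumber_one]
      congr 1
      have hterm : ∀ k ∈ Finset.range (m + 1),
          chainNumber e i (k + 1) 0 * chainNumber e (i + k + 1) (m + 2 - k) q =
          chainNumber e i (k + 1) 0 * chainNumber e (i + k + 1) (m + 1 - k) (q + 1) -
          e (i + (m + 1) + 1) *
            (chainNumber e i (k + 1) 0 * chainNumber e (i + k + 1) (m - k) (q + 1)) := by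
        intro k hk
        rw [Finset.mem_range] at hk
        rw [show m + 2 - k = (m - k) + 2 by omega, chainNumber_add_two,
          show i + k + 1 + (m - k) + 1 = i + (m + 1) + 1 by omega,
          show m + 1 - k = (m - k) + 1 by omega]
        ring
      rw [Finset.sum_congr rfl hterm, Finset.sum_sub_distrib, ← Finset.mul_sum,
        Finset.sum_range_succ (fun k =>
          chainNumber e i (k + 1) 0 * chainNumber e (i + k + 1) (m - k) (q + 1)) m,
        Nat.sub_self, chainNumber_zero]
    have hsum2 : ∑ r ∈ Finset.range q, chainNumber e i (m + 3) r * (catalan (q - 1 - r) : ℤ) =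
        ∑ r ∈ Finset.range q, chainNumber e i (m + 2) (r + 1) * (catalan (q - 1 - r) : ℤ) -
        e (i + (m + 1) + 1) *
          ∑ r ∈ Finset.range q, chainNumber e i (m + 1) (r + 1) * (catalan (q - 1 - r) : ℤ) := by
      rw [Finset.mul_sum, ← Finset.sum_sub_distrib]
      refine Finset.sum_congr rfl fun r _ => ?_
      rw [chainNumber_add_two e i (m + 1) r]
      ring
    rw [show m + 1 + 1 + 1 = m + 1 + 2 by rfl, chainNumber_add_two e i (m + 1) q]
    rw [show m + 1 + 1 = m + 2 by rfl] at ih1 ⊢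
    rw [ih1, ih2, hsum1, show m + 1 + 2 = m + 3 by rfl, hsum2]
    simp only [Nat.add_sub_cancel, Nat.sub_zero]
    ring

theorem chainNumber_add_three (e : ℕ → ℤ) (i m : ℕ) :
    chainNumber e i (m + 3) 0 = ∑ k ∈ Finset.range (m + 2),
      chainNumber e i (k + 1) 0 * chainNumber e (i + k + 1) (m + 2 - k) 0 := by
  rw [chainNumber_succ e i (m + 2) 0 (Or.inr (by omega))]
  simp

theorem chainNumber_two (e : ℕ → ℤ) (i : ℕ) : chainNumber e i 2 0 = 1 - e (i + 1) := by
  rw [chainNumber_add_two, chainNumber_one, chainNumber_zero]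
  simp

/-- At a corner the continuant splits off the edge polynomial of the straight part that follows. -/
theorem continuant_add (e : ℕ → ℤ) (i a : ℕ) (ha : a = 0 ∨ e (i + a) = 0) (r : ℕ)
    (hr : ∀ s, 0 < s → s < r → e (i + a + s) = 1) :
    continuant e i (a + r) = continuant e i a * maxEdgePolynomial r := by
  induction r using Nat.strong_induction_on with
  | _ r ih =>
  rcases r with _ | _ | r
  · simp [maxEdgePolynomial_zero]
  · rw [zero_add, maxEdgePolynomial_one]
    rcases a with _ | a
    · simp [continuant]
    · have h0 : e (i + a + 1) = 0 := by simpa [add_assoc] using ha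
      change X * continuant e i (a + 1) - C (e (i + a + 1)) * (X * continuant e i a) = _
      rw [h0]
      simp [mul_comm]
  · have h1 := ih (r + 1) (by omega) (fun s hs hs' => hr s hs (by omega))
    have h0 := ih r (by omega) (fun s hs hs' => hr s hs (by omega))
    rw [← add_assoc] at h1
    change X * continuant e i (a + r + 1) -
      C (e (i + (a + r) + 1)) * (X * continuant e i (a + r)) = _
    rw [← add_assoc i a r, add_assoc (i + a) r 1, hr (r + 1) (by omega) (by omega), h1, h0, maxEdgePolynomial_add_two]
    simp only [map_one]
    ring

/-! ### Counting the full triangulations of a chain -/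

theorem chainNumber_eq_sum (e : ℕ → ℤ) {i j : ℕ} (hij : i + 2 ≤ j)
    (hc : ∃ c, i < c ∧ c < j ∧ e c = 0) :
    chainNumber e i (j - i) 0 = ∑ k ∈ Finset.Ioo i j,
      chainNumber e i (k - i) 0 * chainNumber e k (j - k) 0 := by
  obtain ⟨m, rfl⟩ := Nat.exists_eq_add_of_le hij
  rcases m with _ | m
  · obtain ⟨c, hc1, hc2, hc0⟩ := hc
    obtain rfl : c = i + 1 := by omega
    have : Finset.Ioo i (i + 2 + 0) = {i + 1} := by
      ext k; simp only [Finset.mem_Ioo, Finset.mem_singleton]; omega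
    rw [this, Finset.sum_singleton, show i + 2 + 0 - i = 2 by omega, chainNumber_two, hc0,
      show i + 1 - i = 1 by omega, show i + 2 + 0 - (i + 1) = 1 by omega, chainNumber_one,
      chainNumber_one]
    simp
  · rw [show i + 2 + (m + 1) - i = m + 3 by omega, chainNumber_add_three]
    refine Finset.sum_bij (fun k _ => i + k + 1) ?_ ?_ ?_ ?_
    · intro k hk
      rw [Finset.mem_range] at hk
      rw [Finset.mem_Ioo]
      omega
    · intro k _ k' _ h
      omega
    · intro k hk
      rw [Finset.mem_Ioo] at hk
      exact ⟨k - i - 1, by rw [Finset.mem_range]; omega, by omega⟩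
    · intro k hk
      rw [show i + k + 1 - i = k + 1 by omega,
        show i + 2 + (m + 1) - (i + k + 1) = m + 2 - k by omega]

theorem chainNumber_eq_zero (e : ℕ → ℤ) (n : ℕ) (hn : 2 ≤ n) (i : ℕ)
    (hflat : ∀ c, i < c → c < i + n → e c = 1) : chainNumber e i n 0 = 0 := by
  induction n using Nat.strong_induction_on generalizing i with
  | _ n ih =>
  obtain ⟨n, rfl⟩ := Nat.exists_eq_add_of_le' hn
  rcases n with _ | n
  · rw [zero_add, chainNumber_two, hflat (i + 1) (by omega) (by omega), sub_self]
  · rw [show n + 1 + 2 = n + 3 by rfl, chainNumber_add_three]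
    refine Finset.sum_eq_zero fun k hk => ?_
    rw [Finset.mem_range] at hk
    rcases k with _ | k
    · rw [ih (n + 2 - 0) (by omega) (by omega) _ (fun c h1 h2 => hflat c (by omega) (by omega)),
        mul_zero]
    · rw [ih (k + 1 + 1) (by omega) (by omega) _ (fun c h1 h2 => hflat c (by omega) (by omega)),
        zero_mul]

namespace IsConvexChain

variable {w : ℕ → Plane} {n m : ℕ} {e : ℕ → ℤ}

/-- The numbers of full triangulations of subchains satisfy the recursion of the chain numbers.
The points from `w m` on may be collinear with `w 0`; subchains starting at `w 0` and reaching
beyond `w m` are therefore excluded. -/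
theorem card_fullTriangulations_eq (h : IsConvexChain w 0 n) (he : ∀ c, e c = 0 ∨ e c = 1)
    (horient : ∀ i k j, i < k → k < j → j ≤ n → (i = 0 → k < m) →
      (0 < orient (w i) (w k) (w j) ↔ ∃ c, i < c ∧ c < j ∧ e c = 0))
    {i j : ℕ} (hij : i < j) (hj : j ≤ n) (him : i = 0 → j ≤ m) :
    ((fullTriangulations w i j).card : ℤ) = chainNumber e i (j - i) 0 := by
  induction hd : j - i using Nat.strong_induction_on generalizing i j with
  | _ d ih =>
  subst hd
  by_cases h1 : j = i + 1
  · rw [show j - i = 1 by omega, chainNumber_one]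
    simp [fullTriangulations, h1]
  · rw [(h.mono (Nat.zero_le i) hj).card_fullTriangulations (by omega)]
    by_cases hc : ∃ c, i < c ∧ c < j ∧ e c = 0
    · rw [chainNumber_eq_sum e (by omega) hc, Finset.filter_true_of_mem]
      · push_cast
        refine Finset.sum_congr rfl fun k hk => ?_
        rw [Finset.mem_Ioo] at hk
        rw [ih (k - i) (by omega) hk.1 (by omega) (fun h0 => by have := him h0; omega) rfl,
          ih (j - k) (by omega) hk.2 hj (by omega) rfl]
      · intro k hk
        rw [Finset.mem_Ioo] at hk
        exact (horient i k j hk.1 hk.2 hj (fun h0 => by have := him h0; omega)).2 hc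
    · rw [chainNumber_eq_zero e _ (by omega), Finset.filter_false_of_mem, Finset.sum_empty,
        Nat.cast_zero]
      · intro k hk
        rw [Finset.mem_Ioo] at hk
        rwa [horient i k j hk.1 hk.2 hj (fun h0 => by have := him h0; omega)]
      · intro c h2 h3
        rcases he c with h0 | h0
        · exact absurd ⟨c, h2, by omega, h0⟩ hc
        · exact h0

/-- The count for the whole polygon, whose last straight side starts at `w m` and ends with the
closing edge. Only vertices before `w m` can be the apex of the base triangle. -/
theorem card_fullTriangulations_closed (h : IsConvexChain w 0 n) (he : ∀ c, e c = 0 ∨ e c = 1)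
    (hm0 : 0 < m) (hmn : m ≤ n) (hc : ∃ c, 0 < c ∧ c < n ∧ e c = 0)
    (horient : ∀ i k j, i < k → k < j → j ≤ n → (i = 0 → k < m) →
      (0 < orient (w i) (w k) (w j) ↔ ∃ c, i < c ∧ c < j ∧ e c = 0))
    (hflat : ∀ c, m < c → c < n → e c = 1)
    (hlast : ∀ k, m ≤ k → k < n → orient (w 0) (w k) (w n) = 0) :
    ((fullTriangulations w 0 n).card : ℤ) =
      chainNumber e 0 n 0 - if m < n then chainNumber e 0 (n - 1) 0 else 0 := by
  have hn : 2 ≤ n := by obtain ⟨c, h1, h2, -⟩ := hc; omega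
  rw [h.card_fullTriangulations (by omega)]
  have hfil : (Finset.Ioo 0 n).filter (fun k => 0 < orient (w 0) (w k) (w n)) =
      (Finset.Ioo 0 n).filter (fun k => k < m) := by
    refine Finset.filter_congr fun k hk => ?_
    rw [Finset.mem_Ioo] at hk
    constructor
    · intro hpos
      by_contra hcon
      rw [hlast k (by omega) hk.2] at hpos
      exact lt_irrefl _ hpos
    · intro hkm
      exact (horient 0 k n hk.1 hk.2 le_rfl (fun _ => hkm)).2 hc
  have hrest : ∑ k ∈ (Finset.Ioo 0 n).filter (fun k => ¬ k < m),
      chainNumber e 0 (k - 0) 0 * chainNumber e k (n - k) 0 =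
      if m < n then chainNumber e 0 (n - 1) 0 else 0 := by
    split_ifs with hlt
    · rw [Finset.sum_eq_single (n - 1)]
      · rw [show n - (n - 1) = 1 by omega, chainNumber_one]
        simp
      · intro k hk hk'
        simp only [Finset.mem_filter, Finset.mem_Ioo] at hk
        rw [chainNumber_eq_zero e (n - k) (by omega) k
          (fun c h1 h2 => hflat c (by omega) (by omega)), mul_zero]
      · intro hk
        simp only [Finset.mem_filter, Finset.mem_Ioo] at hk
        omega
    · apply Finset.sum_eq_zero
      intro k hk
      simp only [Finset.mem_filter, Finset.mem_Ioo] at hk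
      omega
  have htotal := chainNumber_eq_sum e (i := 0) (j := n) (by omega) hc
  rw [← Finset.sum_filter_add_sum_filter_not _ (fun k => k < m), hrest, Nat.sub_zero] at htotal
  rw [hfil, htotal, add_sub_cancel_right]
  push_cast
  refine Finset.sum_congr rfl fun k hk => ?_
  simp only [Finset.mem_filter, Finset.mem_Ioo] at hk
  rw [h.card_fullTriangulations_eq he horient hk.1.1 hk.1.2.le (by omega),
    h.card_fullTriangulations_eq he horient hk.1.2 le_rfl (by omega)]

end IsConvexChain

/-! ### The boundary of a strictly convex polygon -/

/-- `V 0, …, V (l - 1)` are the vertices of a strictly convex polygon in counterclockwise order,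
and `V l = V 0`. -/
structure IsStrictPolygon (V : ℕ → Plane) (l : ℕ) : Prop where
  three_le : 3 ≤ l
  closed : V l = V 0
  orient_pos_of_lt : ∀ a b c, a < b → b < c → c < l → 0 < orient (V a) (V b) (V c)

/-- The piecewise linear parametrization of a polygon that passes through `V i` at time `i`. -/
noncomputable def boundaryPoint (V : ℕ → Plane) (x : ℝ) : Plane :=
  V ⌊x⌋₊ + (x - ⌊x⌋₊) • (V (⌊x⌋₊ + 1) - V ⌊x⌋₊)

theorem boundaryPoint_eq (V : ℕ → Plane) {x : ℝ} {i : ℕ} (h0 : (i : ℝ) ≤ x) (h1 : x ≤ i + 1) :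
    boundaryPoint V x = V i + (x - i) • (V (i + 1) - V i) := by
  rcases h1.eq_or_lt with rfl | h1
  · have : ⌊(i : ℝ) + 1⌋₊ = i + 1 := by exact_mod_cast Nat.floor_natCast (i + 1)
    rw [boundaryPoint, this]
    push_cast
    module
  · have : ⌊x⌋₊ = i := (Nat.floor_eq_iff (by linarith [(Nat.cast_nonneg i : (0 : ℝ) ≤ i)])).2 ⟨h0, h1⟩
    rw [boundaryPoint, this]

theorem boundaryPoint_natCast (V : ℕ → Plane) (i : ℕ) : boundaryPoint V i = V i := by
  rw [boundaryPoint_eq V le_rfl (by linarith)]; simp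

theorem exists_floor {x : ℝ} (hx : 0 ≤ x) : ∃ i : ℕ, (i : ℝ) ≤ x ∧ x < i + 1 :=
  ⟨⌊x⌋₊, Nat.floor_le hx, Nat.lt_floor_add_one x⟩

theorem orient_line_left (a b c d : Plane) (t : ℝ) :
    orient (a + t • (b - a)) c d = (1 - t) * orient a c d + t * orient b c d := by
  simp only [orient, PiLp.add_apply, PiLp.smul_apply, PiLp.sub_apply, smul_eq_mul]; ring

theorem orient_line_mid (a b c d : Plane) (t : ℝ) :
    orient c (a + t • (b - a)) d = (1 - t) * orient c a d + t * orient c b d := by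
  simp only [orient, PiLp.add_apply, PiLp.smul_apply, PiLp.sub_apply, smul_eq_mul]; ring

theorem orient_line_right (a b c d : Plane) (t : ℝ) :
    orient c d (a + t • (b - a)) = (1 - t) * orient c d a + t * orient c d b := by
  simp only [orient, PiLp.add_apply, PiLp.smul_apply, PiLp.sub_apply, smul_eq_mul]; ring

theorem orient_line_line_left (a b c : Plane) (t u : ℝ) :
    orient (a + t • (b - a)) (a + u • (b - a)) c = (u - t) * orient a b c := by
  simp only [orient, PiLp.add_apply, PiLp.smul_apply, PiLp.sub_apply, smul_eq_mul]; ring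

theorem orient_line_line_right (a b c : Plane) (t u : ℝ) :
    orient c (a + t • (b - a)) (a + u • (b - a)) = (u - t) * orient c a b := by
  simp only [orient, PiLp.add_apply, PiLp.smul_apply, PiLp.sub_apply, smul_eq_mul]; ring

namespace IsStrictPolygon

variable {V : ℕ → Plane} {l : ℕ}

theorem orient_pos (h : IsStrictPolygon V l) {a b c : ℕ} (hab : a < b) (hbc : b < c) (hc : c ≤ l)
    (hac : 0 < a ∨ c < l) : 0 < orient (V a) (V b) (V c) := by
  rcases hc.eq_or_lt with rfl | hc
  · rw [h.closed, orient_rotate]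
    exact h.orient_pos_of_lt 0 a b (by omega) hab hbc
  · exact h.orient_pos_of_lt a b c hab hbc hc

theorem orient_nonneg (h : IsStrictPolygon V l) {a b c : ℕ} (hab : a ≤ b) (hbc : b ≤ c)
    (hc : c ≤ l) : 0 ≤ orient (V a) (V b) (V c) := by
  rcases hab.eq_or_lt with rfl | hab
  · simp
  rcases hbc.eq_or_lt with rfl | hbc
  · simp
  by_cases hac : 0 < a ∨ c < l
  · exact (h.orient_pos hab hbc hc hac).le
  · obtain rfl : a = 0 := by omega
    obtain rfl : c = l := by omega
    rw [h.closed]; simp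

/-- Points of three different sides, in order. -/
theorem orient_sides (h : IsStrictPolygon V l) {i j k : ℕ} (hij : i < j) (hjk : j < k)
    (hk : k < l) {t u s : ℝ} (ht0 : 0 ≤ t) (ht1 : t < 1) (hu0 : 0 ≤ u) (hu1 : u < 1)
    (hs0 : 0 ≤ s) (hs1 : s < 1) :
    0 < orient (V i + t • (V (i + 1) - V i)) (V j + u • (V (j + 1) - V j))
      (V k + s • (V (k + 1) - V k)) := by
  have hvv : ∀ a b, a ≤ b → b ≤ k →
      0 ≤ orient (V a) (V b) (V k + s • (V (k + 1) - V k)) := by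
    intro a b hab hbk
    rw [orient_line_right]
    have := h.orient_nonneg hab hbk hk.le
    have := h.orient_nonneg hab (hbk.trans (Nat.le_succ k)) hk
    have : 0 ≤ 1 - s := by linarith
    positivity
  have hvv' : 0 < orient (V i) (V j) (V k + s • (V (k + 1) - V k)) := by
    rw [orient_line_right]
    have h1 := mul_pos (by linarith : 0 < 1 - s) (h.orient_pos hij hjk hk.le (Or.inr hk))
    have h2 := mul_nonneg hs0 (h.orient_nonneg hij.le (hjk.le.trans (Nat.le_succ k)) hk)
    linarith
  have hv : 0 ≤ orient (V (i + 1)) (V j + u • (V (j + 1) - V j))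
      (V k + s • (V (k + 1) - V k)) := by
    rw [orient_line_mid]
    have h1 := mul_nonneg (by linarith : 0 ≤ 1 - u) (hvv (i + 1) j hij hjk.le)
    have h2 := mul_nonneg hu0 (hvv (i + 1) (j + 1) (by omega) hjk)
    linarith
  have hv' : 0 < orient (V i) (V j + u • (V (j + 1) - V j))
      (V k + s • (V (k + 1) - V k)) := by
    rw [orient_line_mid]
    have h1 := mul_pos (by linarith : 0 < 1 - u) hvv'
    have h2 := mul_nonneg hu0 (hvv i (j + 1) (by omega) hjk)
    linarith
  rw [orient_line_left]
  have h1 := mul_pos (by linarith : 0 < 1 - t) hv'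
  have h2 := mul_nonneg ht0 hv
  linarith

theorem orient_boundaryPoint_nonneg (h : IsStrictPolygon V l) {x y z : ℝ} (hx : 0 ≤ x)
    (hxy : x < y) (hyz : y < z) (hz : z < l) :
    0 ≤ orient (boundaryPoint V x) (boundaryPoint V y) (boundaryPoint V z) := by
  obtain ⟨i, hi, hi'⟩ := exists_floor hx
  obtain ⟨j, hj, hj'⟩ := exists_floor (hx.trans hxy.le)
  obtain ⟨k, hk, hk'⟩ := exists_floor (hx.trans (hxy.trans hyz).le)
  have hij : i ≤ j := by
    have : (i : ℝ) < (j + 1 : ℕ) := by push_cast; linarith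
    exact Nat.lt_succ_iff.1 (by exact_mod_cast this)
  have hjk : j ≤ k := by
    have : (j : ℝ) < (k + 1 : ℕ) := by push_cast; linarith
    exact Nat.lt_succ_iff.1 (by exact_mod_cast this)
  have hkl : k < l := by exact_mod_cast hk.trans_lt hz
  rw [boundaryPoint_eq V hi hi'.le, boundaryPoint_eq V hj hj'.le, boundaryPoint_eq V hk hk'.le]
  rcases hij.eq_or_lt with rfl | hij
  · rw [orient_line_line_left, orient_line_right]
    have h1 := h.orient_nonneg (Nat.le_succ i) (c := k + 1) (by omega) hkl
    have h2 : 0 ≤ orient (V i) (V (i + 1)) (V k) := by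
      rcases hjk.eq_or_lt with rfl | hjk
      · simp
      · exact h.orient_nonneg (Nat.le_succ i) hjk hkl.le
    exact mul_nonneg (by linarith) (add_nonneg (mul_nonneg (by linarith) h2)
      (mul_nonneg (by linarith) h1))
  · rcases hjk.eq_or_lt with rfl | hjk
    · rw [orient_line_line_right, orient_line_left]
      have h1 := h.orient_nonneg hij.le (Nat.le_succ j) hkl
      have h2 := h.orient_nonneg (a := i + 1) hij (Nat.le_succ j) hkl
      exact mul_nonneg (by linarith) (add_nonneg (mul_nonneg (by linarith) h1)
        (mul_nonneg (by linarith) h2))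
    · exact (h.orient_sides hij hjk hkl (by linarith) (by linarith) (by linarith) (by linarith)
        (by linarith) (by linarith)).le

/-- Three boundary points make a strict turn when a vertex separates the first from the last,
except if they all lie on the last side, the first one being its end point `V l = V 0`. -/
theorem orient_boundaryPoint_pos (h : IsStrictPolygon V l) {x y z : ℝ} (hx : 0 ≤ x)
    (hxy : x < y) (hyz : y < z) (hz : z < l) {c : ℕ} (hxc : x < c) (hcz : (c : ℝ) < z)
    (hwrap : 0 < x ∨ y < l - 1) :
    0 < orient (boundaryPoint V x) (boundaryPoint V y) (boundaryPoint V z) := by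
  have h3 := h.three_le
  obtain ⟨i, hi, hi'⟩ := exists_floor hx
  obtain ⟨j, hj, hj'⟩ := exists_floor (hx.trans hxy.le)
  obtain ⟨k, hk, hk'⟩ := exists_floor (hx.trans (hxy.trans hyz).le)
  have hij : i ≤ j := by
    have : (i : ℝ) < (j + 1 : ℕ) := by push_cast; linarith
    exact Nat.lt_succ_iff.1 (by exact_mod_cast this)
  have hjk : j ≤ k := by
    have : (j : ℝ) < (k + 1 : ℕ) := by push_cast; linarith
    exact Nat.lt_succ_iff.1 (by exact_mod_cast this)
  have hkl : k < l := by exact_mod_cast hk.trans_lt hz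
  have hic : i < c := by exact_mod_cast hi.trans_lt hxc
  have hck : c ≤ k := by
    have : (c : ℝ) < (k + 1 : ℕ) := by push_cast; linarith
    exact Nat.lt_succ_iff.1 (by exact_mod_cast this)
  rw [boundaryPoint_eq V hi hi'.le, boundaryPoint_eq V hj hj'.le, boundaryPoint_eq V hk hk'.le]
  rcases hij.eq_or_lt with rfl | hij
  · rw [orient_line_line_left, orient_line_right]
    refine mul_pos (by linarith) ?_
    have h1 := h.orient_nonneg (Nat.le_succ i) (c := k + 1) (by omega) hkl
    have h2 := h.orient_nonneg (Nat.le_succ i) (c := k) (by omega) hkl.le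
    by_cases hik : i + 1 < k
    · have h3 := h.orient_pos (Nat.lt_succ_self i) hik hkl.le (Or.inr hkl)
      exact add_pos_of_pos_of_nonneg (mul_pos (by linarith) h3) (mul_nonneg (by linarith) h1)
    · obtain rfl : k = i + 1 := by omega
      obtain rfl : c = i + 1 := by omega
      have h3 := h.orient_pos (Nat.lt_succ_self i) (Nat.lt_succ_self (i + 1)) hkl (by omega)
      exact add_pos_of_nonneg_of_pos (mul_nonneg (by linarith) h2) (mul_pos (by linarith) h3)
  · rcases hjk.eq_or_lt with rfl | hjk
    · rw [orient_line_line_right, orient_line_left]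
      refine mul_pos (by linarith) ?_
      have h1 := h.orient_nonneg hij.le (Nat.le_succ j) hkl
      have h2 := h.orient_nonneg (a := i + 1) hij (Nat.le_succ j) hkl
      by_cases hac : 0 < i ∨ j + 1 < l
      · have h3 := h.orient_pos hij (Nat.lt_succ_self j) hkl hac
        exact add_pos_of_pos_of_nonneg (mul_pos (by linarith) h3) (mul_nonneg (by linarith) h2)
      · obtain rfl : i = 0 := by omega
        have hjl : (j : ℝ) = l - 1 := by
          have : j + 1 = l := by omega
          rw [← this]; push_cast; ring
        have hx0 : 0 < x := by
          rcases hwrap with h' | h'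
          · exact h'
          · linarith
        have h3 := h.orient_pos (a := 1) (b := j) (c := j + 1) (by omega) (by omega) hkl
          (Or.inl one_pos)
        refine add_pos_of_nonneg_of_pos (mul_nonneg (by linarith) h1) (mul_pos ?_ h3)
        simpa using hx0
    · exact h.orient_sides hij hjk hkl (by linarith) (by linarith) (by linarith) (by linarith)
        (by linarith) (by linarith)

theorem orient_boundaryPoint_eq_zero {x y z : ℝ} {i : ℕ} (hx : (i : ℝ) ≤ x)
    (hxy : x < y) (hyz : y < z) (hz : z ≤ i + 1) :
    orient (boundaryPoint V x) (boundaryPoint V y) (boundaryPoint V z) = 0 := by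
  rw [boundaryPoint_eq V hx (by linarith), boundaryPoint_eq V (i := i) (by linarith) (by linarith),
    boundaryPoint_eq V (i := i) (by linarith) hz, orient_line_line_left, orient_line_right]
  simp

theorem orient_boundaryPoint_last (h : IsStrictPolygon V l) {y z : ℝ}
    (hy : (l : ℝ) - 1 ≤ y) (hyz : y < z) (hz : z < l) :
    orient (boundaryPoint V 0) (boundaryPoint V y) (boundaryPoint V z) = 0 := by
  have h3 := h.three_le
  have e : boundaryPoint V 0 = boundaryPoint V l := by
    have := boundaryPoint_natCast V 0
    rw [Nat.cast_zero] at this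
    rw [this, boundaryPoint_natCast, h.closed]
  have hl : ((l - 1 : ℕ) : ℝ) = l - 1 := by
    rw [Nat.cast_sub (by omega)]; simp
  rw [e, ← orient_rotate]
  exact orient_boundaryPoint_eq_zero (i := l - 1) (by rw [hl]; exact hy) hyz hz
    (by rw [hl]; linarith)

theorem boundaryPoint_injOn (h : IsStrictPolygon V l) :
    Set.InjOn (boundaryPoint V) (Set.Ico 0 l) := by
  have h3 : (3 : ℝ) ≤ l := by exact_mod_cast h.three_le
  -- two different parameters can be completed to a strict turn
  have key : ∀ x y : ℝ, 0 ≤ x → x < y → y < l → boundaryPoint V x ≠ boundaryPoint V y := by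
    intro x y hx hxy hy he
    by_cases hy1 : y < l - 1
    · have := h.orient_boundaryPoint_pos (x := x) (y := y) (z := l - 1 / 2) (c := l - 1) hx hxy
        (by linarith) (by linarith)
        (by rw [Nat.cast_sub (by have := h.three_le; omega)]; push_cast; linarith)
        (by rw [Nat.cast_sub (by have := h.three_le; omega)]; push_cast; linarith) (Or.inr hy1)
      rw [he] at this
      simp at this
    · by_cases hx1 : 1 ≤ x
      · have := h.orient_boundaryPoint_pos (x := 1 / 2) (y := x) (z := y) (c := 1) (by norm_num)
          (by linarith) hxy hy (by norm_num) (by push_cast; linarith) (Or.inl (by norm_num))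
        rw [he] at this
        simp at this
      · have := h.orient_boundaryPoint_pos (x := x) (y := (x + 1) / 2) (z := y) (c := 1) hx
          (by linarith) (by linarith) hy (by push_cast; linarith) (by push_cast; linarith)
          (Or.inr (by linarith))
        rw [he] at this
        simp at this
  intro x hx y hy he
  by_contra hne
  rcases lt_or_gt_of_ne hne with hlt | hlt
  · exact key x y hx.1 hlt hy.2 he
  · exact key y x hy.1 hlt hx.2 he.symm

end IsStrictPolygon

/-! ### Counting the full triangulations of a weakly convex polygon -/

/-- The increasing enumeration of a finite set of reals, by natural numbers. -/
theorem exists_increasing_enumeration (Θ : Finset ℝ) : ∃ x : ℕ → ℝ,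
    (∀ a b, a < b → b < Θ.card → x a < x b) ∧ ∀ y, y ∈ Θ ↔ ∃ k < Θ.card, x k = y := by
  refine ⟨fun k => if h : k < Θ.card then Θ.orderEmbOfFin rfl ⟨k, h⟩ else 0, ?_, ?_⟩
  · intro a b hab hb
    simp only [hb, hab.trans hb, dif_pos]
    exact (Θ.orderEmbOfFin rfl).strictMono hab
  · intro y
    constructor
    · intro hy
      have : y ∈ Set.range (Θ.orderEmbOfFin rfl) := by
        rw [Finset.range_orderEmbOfFin]; exact hy
      obtain ⟨⟨k, hk⟩, rfl⟩ := this
      exact ⟨k, hk, by simp [hk]⟩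
    · rintro ⟨k, hk, rfl⟩
      simp only [hk, dif_pos]
      exact Finset.orderEmbOfFin_mem _ _ _

/-- The `k`-th element of a finite set is below `y` iff more than `k` elements are. -/
theorem lt_iff_lt_card_filter {Θ : Finset ℝ} {x : ℕ → ℝ}
    (hmono : ∀ a b, a < b → b < Θ.card → x a < x b) (hmem : ∀ y, y ∈ Θ ↔ ∃ k < Θ.card, x k = y)
    {k : ℕ} (hk : k < Θ.card) (y : ℝ) : x k < y ↔ k < (Θ.filter (· < y)).card := by
  have hinj : ∀ m ≤ Θ.card, ((Finset.range m).image x).card = m := by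
    intro m hm
    rw [Finset.card_image_of_injOn, Finset.card_range]
    intro a ha b hb hab
    simp only [Finset.coe_range, Set.mem_Iio] at ha hb
    by_contra hne
    rcases lt_or_gt_of_ne hne with hlt | hlt
    · exact (hmono a b hlt (by omega)).ne hab
    · exact (hmono b a hlt (by omega)).ne' hab
  constructor
  · intro hxy
    have hsub : (Finset.range (k + 1)).image x ⊆ Θ.filter (· < y) := by
      intro z hz
      obtain ⟨a, ha, rfl⟩ := Finset.mem_image.1 hz
      rw [Finset.mem_range] at ha
      refine Finset.mem_filter.2 ⟨(hmem _).2 ⟨a, by omega, rfl⟩, ?_⟩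
      rcases Nat.lt_succ_iff_lt_or_eq.1 ha with h' | rfl
      · exact (hmono a k h' hk).trans hxy
      · exact hxy
    have := Finset.card_le_card hsub
    rw [hinj (k + 1) hk] at this
    omega
  · intro hlt
    by_contra! hcon
    have hsub : Θ.filter (· < y) ⊆ (Finset.range k).image x := by
      intro z hz
      obtain ⟨hz, hzy⟩ := Finset.mem_filter.1 hz
      obtain ⟨a, ha, rfl⟩ := (hmem z).1 hz
      refine Finset.mem_image.2 ⟨a, Finset.mem_range.2 ?_, rfl⟩
      by_contra! hka
      rcases hka.eq_or_lt with rfl | hka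
      · linarith
      · linarith [hmono k a hka ha]
    have := Finset.card_le_card hsub
    rw [hinj k hk.le] at this
    omega

open Classical in
/-- For a set of parameters that contains all vertices, the triangulations that use all the points
are counted by the product of the maximal edge polynomials. -/
theorem IsStrictPolygon.card_full {V : ℕ → Plane} {l : ℕ} (h : IsStrictPolygon V l) (Θ : Finset ℝ)
    (hΘ : ∀ x ∈ Θ, 0 ≤ x ∧ x < l) (hint : ∀ i : ℕ, i < l → (i : ℝ) ∈ Θ) :
    (((triangulations (Θ.image (boundaryPoint V))).filter
      (fun T => usedPoints T = Θ.image (boundaryPoint V))).card : ℤ) =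
    catalanPairing ℤ (∏ i ∈ Finset.range l,
      maxEdgePolynomial (Θ.filter (fun x => (i : ℝ) ≤ x ∧ x < i + 1)).card) := by
  have h3 := h.three_le
  obtain ⟨x, hmono, hmem⟩ := exists_increasing_enumeration Θ
  have hlt : ∀ {k : ℕ}, k < Θ.card → ∀ y, x k < y ↔ k < (Θ.filter (· < y)).card :=
    fun hk y => lt_iff_lt_card_filter hmono hmem hk y
  -- `B i` is the position of the vertex `V i`, and `b i` the weight of the side that follows
  set B : ℕ → ℕ := fun i => (Θ.filter (· < (i : ℝ))).card with hB
  set b : ℕ → ℕ := fun i => (Θ.filter (fun x => (i : ℝ) ≤ x ∧ x < i + 1)).card with hb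
  have hBs : ∀ i, B (i + 1) = B i + b i := by
    intro i
    have hd : Disjoint (Θ.filter (· < (i : ℝ)))
        (Θ.filter (fun x => (i : ℝ) ≤ x ∧ x < i + 1)) := by
      rw [Finset.disjoint_filter]
      intro y _ h1 h2
      linarith
    simp only [hB, hb]
    rw [← Finset.card_union_of_disjoint hd]
    congr 1
    ext y
    simp only [Finset.mem_filter, Finset.mem_union]
    push_cast
    constructor
    · rintro ⟨h1, h2⟩
      rcases lt_or_ge y i with h' | h'
      · exact Or.inl ⟨h1, h'⟩
      · exact Or.inr ⟨h1, h', h2⟩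
    · rintro (⟨h1, h2⟩ | ⟨h1, -, h2⟩)
      · exact ⟨h1, by linarith⟩
      · exact ⟨h1, h2⟩
  have hBl : B l = Θ.card := by
    simp only [hB]
    rw [Finset.filter_true_of_mem fun y hy => (hΘ y hy).2]
  have hB0 : B 0 = 0 := by
    simp only [hB]
    rw [Finset.card_eq_zero, Finset.filter_eq_empty_iff]
    intro y hy
    have := (hΘ y hy).1
    simpa using this
  have hBx : ∀ i, i < l → B i < Θ.card ∧ x (B i) = i := by
    intro i hi
    obtain ⟨k, hk, hxk⟩ := (hmem i).1 (hint i hi)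
    have h1 : ¬ k < B i := fun hcon => by
      have := (hlt hk i).2 hcon
      linarith
    have h2 : ¬ B i < k := fun hcon => by
      have h' := hmono _ _ hcon hk
      rw [hxk] at h'
      exact lt_irrefl _ ((hlt (hcon.trans hk) i).1 h')
    have : B i = k := by omega
    rw [this]
    exact ⟨hk, hxk⟩
  have hBlt : ∀ {k : ℕ} (i : ℕ), k < Θ.card → (x k < i ↔ k < B i) := fun i hk => hlt hk i
  have hx0 : ∀ {k : ℕ}, k < Θ.card → 0 ≤ x k ∧ x k < l :=
    fun hk => hΘ _ ((hmem _).2 ⟨_, hk, rfl⟩)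
  have hb1 : 1 ≤ b (l - 1) := by
    have h1 := hBs (l - 1)
    rw [show l - 1 + 1 = l by omega, hBl] at h1
    have := (hBx (l - 1) (by omega)).1
    omega
  obtain ⟨n, hn⟩ : ∃ n, Θ.card = n + 1 :=
    ⟨Θ.card - 1, by have := (hBx 0 (by omega)).1; omega⟩
  have hcard : n + 1 = B (l - 1) + b (l - 1) := by
    rw [← hBs, show l - 1 + 1 = l by omega, hBl, hn]
  set e : ℕ → ℤ := fun c => if ∃ i : ℕ, x c = i then 0 else 1 with he
  have he1 : ∀ i c, c < Θ.card → B i < c → c < B (i + 1) → i < l → e c = 1 := by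
    intro i c hc h1 h2 hi
    have h1' : (i : ℝ) < x c := by
      rw [← (hBx i hi).2]; exact hmono _ _ h1 hc
    have h2' : x c < i + 1 := by exact_mod_cast (hBlt (i + 1) hc).2 h2
    simp only [he]
    rw [if_neg]
    rintro ⟨a, ha⟩
    rw [ha] at h1' h2'
    have h1'' : i < a := by exact_mod_cast h1'
    have h2'' : a < i + 1 := by exact_mod_cast h2'
    omega
  have he0 : ∀ i, i < l → e (B i) = 0 := by
    intro i hi
    simp only [he]
    rw [if_pos ⟨i, (hBx i hi).2⟩]
  have hcont : ∀ i, i < l → ∀ r, r ≤ b i → continuant e 0 (B i + r) =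
      continuant e 0 (B i) * maxEdgePolynomial r := by
    intro i hi r hr
    refine continuant_add e 0 (B i) (Or.inr (by rw [zero_add]; exact he0 i hi)) r ?_
    intro s hs hs'
    have h2 : B i + s < B (i + 1) := by rw [hBs]; omega
    rw [zero_add]
    refine he1 i _ ?_ (by omega) h2 hi
    have : B (i + 1) ≤ Θ.card := Finset.card_filter_le _ _
    omega
  have hprod : ∀ i, i < l → continuant e 0 (B i) = ∏ j ∈ Finset.range i, maxEdgePolynomial (b j) := by
    intro i
    induction i with
    | zero => intro _; rw [hB0]; simp [continuant]
    | succ i ih =>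
      intro hi
      rw [hBs, hcont i (by omega) _ le_rfl, ih (by omega), Finset.prod_range_succ]
  set w : ℕ → Plane := fun k => boundaryPoint V (x k) with hw
  have hchain : IsConvexChain w 0 n := by
    constructor
    · intro a ha c hc hac
      rw [Set.mem_Icc] at ha hc
      have := h.boundaryPoint_injOn (hx0 (by omega : a < Θ.card)) (hx0 (by omega : c < Θ.card)) hac
      by_contra hne
      rcases lt_or_gt_of_ne hne with h' | h'
      · exact (hmono _ _ h' (by omega)).ne this
      · exact (hmono _ _ h' (by omega)).ne' this
    · intro a c d _ hac hcd hd
      exact h.orient_boundaryPoint_nonneg (hx0 (by omega)).1 (hmono _ _ hac (by omega))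
        (hmono _ _ hcd (by omega)) (hx0 (by omega)).2
  have hpts : chainPoints w 0 n = Θ.image (boundaryPoint V) := by
    ext p
    rw [mem_chainPoints, Finset.mem_image]
    constructor
    · rintro ⟨k, -, hk, rfl⟩
      exact ⟨x k, (hmem _).2 ⟨k, by omega, rfl⟩, rfl⟩
    · rintro ⟨y, hy, rfl⟩
      obtain ⟨k, hk, rfl⟩ := (hmem y).1 hy
      exact ⟨k, by omega, by omega, rfl⟩
  have hB12 : B 1 < B 2 := by
    rw [← hBlt 2 (hBx 1 (by omega)).1, (hBx 1 (by omega)).2]; norm_num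
  have hB01 : 0 < B 1 := by
    rw [← hB0, ← hBlt 1 (hBx 0 (by omega)).1, (hBx 0 (by omega)).2]; norm_num
  have hB2 := (hBx 2 (by omega)).1
  have hl1 : ((l - 1 : ℕ) : ℝ) = l - 1 := by rw [Nat.cast_sub (by omega)]; simp
  have hBm : 0 < B (l - 1) := by
    rw [← hB0, ← hBlt (l - 1) (hBx 0 (by omega)).1, (hBx 0 (by omega)).2]
    exact_mod_cast (by omega : 0 < l - 1)
  have hx00 : x 0 = 0 := by
    have := (hBx 0 (by omega)).2
    rw [hB0] at this
    simpa using this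
  have hfull : (triangulations (Θ.image (boundaryPoint V))).filter
      (fun T => usedPoints T = Θ.image (boundaryPoint V)) = fullTriangulations w 0 n := by
    rw [fullTriangulations, if_neg (by omega), hpts]
  rw [hfull, hchain.card_fullTriangulations_closed (e := e) (m := B (l - 1))]
  · rw [show l = l - 1 + 1 by omega, Finset.prod_range_succ, Nat.add_sub_cancel]
    change _ = catalanPairing ℤ ((∏ i ∈ Finset.range (l - 1), maxEdgePolynomial (b i)) *
      maxEdgePolynomial (b (l - 1)))
    rw [← hprod (l - 1) (by omega)]
    obtain ⟨r, hr⟩ := Nat.exists_eq_add_of_le' hb1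
    have hnr : n = B (l - 1) + r := by omega
    rw [chainNumber, hnr, hcont (l - 1) (by omega) r (by omega), hr]
    rcases r with _ | r
    · rw [if_neg (by omega), zero_add, maxEdgePolynomial_zero, maxEdgePolynomial_one]
      rw [sub_zero]
      congr 1
      ring
    · rw [if_pos (by omega), chainNumber, show B (l - 1) + (r + 1) - 1 = B (l - 1) + r by omega,
        hcont (l - 1) (by omega) r (by omega), ← map_sub, show r + 1 + 1 = r + 2 by rfl,
        maxEdgePolynomial_add_two]
      congr 1
      ring
  · intro c
    simp only [he]
    split_ifs
    · exact Or.inl rfl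
    · exact Or.inr rfl
  · exact hBm
  · omega
  · exact ⟨B 1, hB01, by omega, he0 1 (by omega)⟩
  · intro i k j hik hkj hjn hi0
    have hxi := hx0 (by omega : i < Θ.card)
    have hxj := hx0 (by omega : j < Θ.card)
    constructor
    · intro hpos
      by_contra hcon
      obtain ⟨a, ha, ha'⟩ := exists_floor hxi.1
      -- without a corner in between, the three points lie on a common side
      have hle : x j ≤ a + 1 := by
        by_contra! hgt
        have hal : a + 1 < l := by
          have : ((a + 1 : ℕ) : ℝ) < l := by push_cast; linarith
          exact_mod_cast this
        have hBa := hBx (a + 1) hal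
        have h1 : i < B (a + 1) := (hBlt (a + 1) (by omega)).1 (by push_cast; exact ha')
        have h2 : B (a + 1) < j := by
          by_contra! hge
          have : x j ≤ x (B (a + 1)) := by
            rcases hge.eq_or_lt with h' | h'
            · rw [h']
            · exact (hmono _ _ h' hBa.1).le
          rw [hBa.2] at this
          push_cast at this
          linarith
        exact hcon ⟨_, h1, h2, he0 _ hal⟩
      have := IsStrictPolygon.orient_boundaryPoint_eq_zero (V := V) ha
        (hmono i k hik (by omega)) (hmono k j hkj (by omega)) hle
      simp only [hw] at hpos
      linarith
    · rintro ⟨c, hic, hcj, hc0⟩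
      have : ∃ a : ℕ, x c = a := by
        by_contra hcon
        simp only [he, if_neg hcon] at hc0
        exact one_ne_zero hc0
      obtain ⟨a, ha⟩ := this
      refine h.orient_boundaryPoint_pos (c := a) hxi.1 (hmono i k hik (by omega))
        (hmono k j hkj (by omega)) hxj.2 (by rw [← ha]; exact hmono i c hic (by omega))
        (by rw [← ha]; exact hmono c j hcj (by omega)) ?_
      rcases Nat.eq_zero_or_pos i with rfl | hi
      · right
        rw [← hl1]
        exact (hBlt (l - 1) (by omega)).2 (hi0 rfl)
      · left
        exact (hx0 (by omega : 0 < Θ.card)).1.trans_lt (hmono 0 i hi (by omega))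
  · intro c h1 h2
    refine he1 (l - 1) c (by omega) h1 ?_ (by omega)
    rw [show l - 1 + 1 = l by omega, hBl]
    omega
  · intro k hk hkn
    have h1 : (l : ℝ) - 1 ≤ x k := by
      rw [← hl1]
      by_contra! hcon
      have := (hBlt (l - 1) (by omega : k < Θ.card)).1 hcon
      omega
    have := h.orient_boundaryPoint_last h1 (hmono k n hkn (by omega)) (hx0 (by omega)).2
    simp only [hw, hx00]
    exact this

/-! ### Weakly convex polygons and their boundary parametrization -/

/-- A finite configuration and its extremal points have the same convex hull (Krein-Milman). -/
theorem convexHull_extr (S : Finset Plane) :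
    convexHull ℝ (extr S) = convexHull ℝ (S : Set Plane) := by
  apply Set.Subset.antisymm (convexHull_mono fun p hp => hp.1)
  set K := convexHull ℝ (S : Set Plane) with hK
  have hKc : Convex ℝ K := convex_convexHull ℝ _
  have hcomp : IsCompact K := S.finite_toSet.isCompact_convexHull ℝ
  have hext : K.extremePoints ℝ ⊆ extr S := by
    intro q hq
    have hqS : q ∈ S := extremePoints_convexHull_subset hq
    refine ⟨hqS, fun heq => ?_⟩
    have hq' := ((hKc.mem_extremePoints_iff_mem_sdiff_convexHull_sdiff).1 hq).2
    apply hq'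
    have : q ∈ convexHull ℝ ((S : Set Plane) \ {q}) := by rw [heq]; exact hq.1
    exact convexHull_mono (Set.sdiff_subset_sdiff_left (subset_convexHull ℝ _)) this
  have hfin : (extr S).Finite := S.finite_toSet.subset fun p hp => hp.1
  have hclosed : IsClosed (convexHull ℝ (extr S)) := hfin.isClosed_convexHull ℝ
  rw [← closure_convexHull_extremePoints hcomp hKc]
  exact closure_minimal (convexHull_mono hext) hclosed

namespace IsStrictPolygon

variable {V : ℕ → Plane} {l : ℕ}

theorem orient_side_nonneg (h : IsStrictPolygon V l) {i j : ℕ} (hi : i < l) (hj : j < l) :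
    0 ≤ orient (V i) (V (i + 1)) (V j) := by
  rcases le_or_gt j i with hji | hij
  · rw [orient_rotate]
    exact h.orient_nonneg hji (Nat.le_succ i) hi
  · exact h.orient_nonneg (Nat.le_succ i) hij hj.le

/-- A point to the left of all sides lies in the polygon: it lies in one of the triangles of the
fan from `V 0`. -/
theorem mem_convexHull_of_orient_nonneg (h : IsStrictPolygon V l) {q : Plane}
    (hq : ∀ i, i < l → 0 ≤ orient (V i) (V (i + 1)) q) :
    q ∈ convexHull ℝ (V '' Set.Iio l) := by
  have h3 := h.three_le
  obtain ⟨k, hk1, hk2, hk, hk'⟩ : ∃ k, 1 ≤ k ∧ k + 1 < l ∧ 0 ≤ orient (V 0) (V k) q ∧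
      orient (V 0) (V (k + 1)) q ≤ 0 := by
    by_contra! hcon
    have hall : ∀ k, k + 1 < l → 0 ≤ orient (V 0) (V (k + 1)) q := by
      intro k
      induction k with
      | zero => intro _; exact hq 0 (by omega)
      | succ k ih => intro hk; exact (hcon (k + 1) (by omega) hk (ih (by omega))).le
    have h1 := hcon (l - 2) (by omega) (by omega)
      (by have := hall (l - 3) (by omega); rwa [show l - 3 + 1 = l - 2 by omega] at this)
    have h2 := hq (l - 1) (by omega)
    rw [show l - 2 + 1 = l - 1 by omega] at h1
    rw [show l - 1 + 1 = l by omega, h.closed] at h2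
    have : orient (V (l - 1)) (V 0) q = -orient (V 0) (V (l - 1)) q := by
      simp only [orient]; ring
    linarith
  have hmem := mem_convexHull_triangle (h.orient_pos (a := 0) (b := k) (c := k + 1) (by omega)
    (by omega) (by omega) (Or.inr hk2)) hk (hq k (by omega)) (by
      have : orient (V (k + 1)) (V 0) q = -orient (V 0) (V (k + 1)) q := by
        simp only [orient]; ring
      linarith)
  refine convexHull_mono ?_ hmem
  rintro p (rfl | rfl | rfl)
  · exact ⟨0, by simp; omega, rfl⟩
  · exact ⟨k, by simp; omega, rfl⟩
  · exact ⟨k + 1, by simp; omega, rfl⟩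

/-- Every frontier point of a strictly convex polygon lies on one of its sides. -/
theorem exists_mem_segment (h : IsStrictPolygon V l) {p : Plane}
    (hp : p ∈ frontier (convexHull ℝ (V '' Set.Iio l)))
    (hpK : p ∈ convexHull ℝ (V '' Set.Iio l)) :
    ∃ i, i < l ∧ p ∈ segment ℝ (V i) (V (i + 1)) := by
  have h3 := h.three_le
  have hside : ∀ i, i < l → ∀ q ∈ V '' Set.Iio l, 0 ≤ orient (V i) (V (i + 1)) q := by
    rintro i hi _ ⟨j, hj, rfl⟩
    exact h.orient_side_nonneg hi hj
  obtain ⟨i, hi, hip⟩ : ∃ i, i < l ∧ orient (V i) (V (i + 1)) p ≤ 0 := by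
    by_contra! hcon
    have hopen : IsOpen (⋂ i ∈ Set.Iio l, {q : Plane | 0 < orient (V i) (V (i + 1)) q}) := by
      refine (Set.finite_Iio l).isOpen_biInter fun i _ => ?_
      have hcont : Continuous fun q : Plane => orient (V i) (V (i + 1)) q := by
        unfold orient
        fun_prop
      exact isOpen_lt continuous_const hcont
    have hsub : (⋂ i ∈ Set.Iio l, {q : Plane | 0 < orient (V i) (V (i + 1)) q}) ⊆
        convexHull ℝ (V '' Set.Iio l) := by
      intro q hq
      simp only [Set.mem_iInter, Set.mem_Iio, Set.mem_ofPred_eq] at hq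
      exact h.mem_convexHull_of_orient_nonneg fun i hi => (hq i hi).le
    have : p ∈ interior (convexHull ℝ (V '' Set.Iio l)) := by
      refine interior_maximal hsub hopen ?_
      simp only [Set.mem_iInter, Set.mem_Iio, Set.mem_ofPred_eq]
      exact hcon
    exact hp.2 this
  refine ⟨i, hi, ?_⟩
  have h0 := le_antisymm hip (orient_nonneg_of_mem_convexHull (hside i hi) hpK)
  rw [← convexHull_pair]
  refine convexHull_mono ?_ (mem_convexHull_of_orient_eq_zero (hside i hi) hpK h0)
  rintro _ ⟨⟨j, hj, rfl⟩, hj0⟩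
  rw [Set.mem_Iio] at hj
  rcases lt_trichotomy j i with hji | rfl | hij
  · by_cases hc : 0 < j ∨ i + 1 < l
    · have := h.orient_pos hji (Nat.lt_succ_self i) hi hc
      rw [← orient_rotate] at this
      exact absurd hj0 this.ne'
    · obtain rfl : j = 0 := by omega
      right
      rw [Set.mem_singleton_iff, show i + 1 = l by omega, h.closed]
  · exact Or.inl rfl
  · rcases (Nat.succ_le_of_lt hij).eq_or_lt with rfl | hij'
    · exact Or.inr rfl
    · have := h.orient_pos (Nat.lt_succ_self i) hij' hj.le (Or.inr hj)
      exact absurd hj0 this.ne'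

/-- Points of the `i`-th side, in terms of the boundary parametrization. -/
theorem exists_param_of_mem_segment {p : Plane} {i : ℕ}
    (hp : p ∈ segment ℝ (V i) (V (i + 1))) :
    p = V (i + 1) ∨ ∃ x : ℝ, (i : ℝ) ≤ x ∧ x < i + 1 ∧ boundaryPoint V x = p := by
  rw [segment_eq_image'] at hp
  obtain ⟨t, ⟨ht0, ht1⟩, rfl⟩ := hp
  rcases ht1.eq_or_lt with rfl | ht1
  · left; simp
  · right
    refine ⟨i + t, by linarith, by linarith, ?_⟩
    rw [boundaryPoint_eq V (i := i) (by linarith) (by linarith)]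
    simp

end IsStrictPolygon

/-- A weakly convex polygon consists of the boundary points of a strictly convex polygon at a finite
set `Θ` of parameters that contains all vertices, and its weights count the parameters between
consecutive vertices. -/
theorem IsWeaklyConvexPolygon.exists_param {l : ℕ} (hl : 3 ≤ l) {a : Fin l → ℕ}
    {S : Finset Plane} (hS : IsWeaklyConvexPolygon a S) :
    ∃ (V : ℕ → Plane) (Θ : Finset ℝ), IsStrictPolygon V l ∧ (∀ x ∈ Θ, 0 ≤ x ∧ x < l) ∧
      (∀ i : ℕ, i < l → (i : ℝ) ∈ Θ) ∧ Θ.image (boundaryPoint V) = S ∧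
      V '' Set.Iio l = extr S ∧
      ∀ i : Fin l, (Θ.filter (fun x => ((i : ℕ) : ℝ) ≤ x ∧ x < (i : ℕ) + 1)).card = a i := by
  obtain ⟨hfr, v, hv, hpos, hcount⟩ := hS
  have hl0 : 0 < l := by omega
  set V : ℕ → Plane := fun i => v ⟨i % l, Nat.mod_lt _ hl0⟩ with hV
  have hVi : ∀ i : Fin l, V i = v i := by
    intro i
    simp only [hV]
    congr 1
    exact Fin.ext (Nat.mod_eq_of_lt i.2)
  have hVlt : ∀ i (hi : i < l), V i = v ⟨i, hi⟩ := fun i hi => hVi ⟨i, hi⟩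
  have hP : IsStrictPolygon V l := by
    refine ⟨hl, ?_, ?_⟩
    · simp [hV]
    · intro b c d hbc hcd hd
      rw [hVlt b (by omega), hVlt c (by omega), hVlt d hd]
      exact hpos _ _ _ (by simpa [Fin.lt_def] using hbc) (by simpa [Fin.lt_def] using hcd)
  have hrange : V '' Set.Iio l = extr S := by
    rw [← hv]
    ext p
    constructor
    · rintro ⟨i, hi, rfl⟩
      exact ⟨⟨i, hi⟩, (hVlt i hi).symm⟩
    · rintro ⟨i, rfl⟩
      exact ⟨i, i.2, hVi i⟩
  have hVS : ∀ i, V i ∈ S := by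
    intro i
    have : V i ∈ extr S := by rw [← hv]; exact ⟨_, rfl⟩
    exact this.1
  have hhull : convexHull ℝ (V '' Set.Iio l) = convexHull ℝ (S : Set Plane) := by
    rw [hrange, convexHull_extr]
  have hVsucc : ∀ i, i < l → ∃ x : ℝ, 0 ≤ x ∧ x < l ∧ boundaryPoint V x = V (i + 1) ∧
      ¬ ((i : ℝ) ≤ x ∧ x < i + 1) := by
    intro i hi
    rcases (Nat.succ_le_of_lt hi).eq_or_lt with h' | h'
    · refine ⟨0, le_rfl, by exact_mod_cast hl0, ?_, ?_⟩
      · have := boundaryPoint_natCast V 0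
        rw [Nat.cast_zero] at this
        rw [this, show i + 1 = l from h', hP.closed]
      · rintro ⟨h0, -⟩
        have : i ≤ 0 := by exact_mod_cast h0
        omega
    · refine ⟨(i + 1 : ℕ), by positivity, by exact_mod_cast h', boundaryPoint_natCast V _, ?_⟩
      rintro ⟨-, h1⟩
      push_cast at h1
      exact lt_irrefl _ h1
  have hex : ∀ p ∈ S, ∃ x : ℝ, (0 ≤ x ∧ x < l) ∧ boundaryPoint V x = p := by
    intro p hp
    have hpK := subset_convexHull ℝ (S : Set Plane) (Finset.mem_coe.2 hp)
    have hpf := hfr (Finset.mem_coe.2 hp)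
    rw [← hhull] at hpK hpf
    obtain ⟨i, hi, hseg⟩ := hP.exists_mem_segment hpf hpK
    rcases IsStrictPolygon.exists_param_of_mem_segment hseg with rfl | ⟨x, h0, h1, rfl⟩
    · obtain ⟨x, h0, h1, h2, -⟩ := hVsucc i hi
      exact ⟨x, ⟨h0, h1⟩, h2⟩
    · refine ⟨x, ⟨(Nat.cast_nonneg i).trans h0, ?_⟩, rfl⟩
      have : ((i + 1 : ℕ) : ℝ) ≤ l := by exact_mod_cast hi
      push_cast at this
      linarith
  choose! f hf hf' using hex
  -- the parameter of a point is unique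
  have huniq : ∀ x : ℝ, 0 ≤ x → x < l → boundaryPoint V x ∈ S → f (boundaryPoint V x) = x :=
    fun x h0 h1 hx => hP.boundaryPoint_injOn (hf _ hx) ⟨h0, h1⟩ (hf' _ hx)
  have hmemΘ : ∀ x : ℝ, 0 ≤ x → x < l → boundaryPoint V x ∈ S → x ∈ S.image f :=
    fun x h0 h1 hx => Finset.mem_image.2 ⟨_, hx, huniq x h0 h1 hx⟩
  refine ⟨V, S.image f, hP, ?_, ?_, ?_, hrange, ?_⟩
  · intro x hx
    obtain ⟨p, hp, rfl⟩ := Finset.mem_image.1 hx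
    exact hf p hp
  · intro i hi
    refine hmemΘ i (by positivity) (by exact_mod_cast hi) ?_
    rw [boundaryPoint_natCast]
    exact hVS i
  · rw [Finset.image_image]
    ext p
    rw [Finset.mem_image]
    constructor
    · rintro ⟨q, hq, rfl⟩
      simpa [hf' q hq] using hq
    · intro hp
      exact ⟨p, hp, hf' p hp⟩
  · intro i
    have hrot : v (finRotate l i) = V (i + 1) := by
      simp only [hV]
      congr 1
      obtain ⟨m, rfl⟩ := Nat.exists_eq_add_of_le' hl0
      rw [finRotate_apply]
      apply Fin.ext
      rw [Fin.val_add]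
      simp
    have hc := hcount i
    rw [hrot, ← hVi i] at hc
    set Φ := (S.image f).filter (fun x => ((i : ℕ) : ℝ) ≤ x ∧ x < (i : ℕ) + 1) with hΦ
    have hset : (S : Set Plane) ∩ segment ℝ (V i) (V (i + 1)) =
        ((insert (V (i + 1)) (Φ.image (boundaryPoint V)) : Finset Plane) : Set Plane) := by
      ext p
      rw [Finset.mem_coe, Finset.mem_insert, Finset.mem_image]
      constructor
      · rintro ⟨hp, hseg⟩
        rcases IsStrictPolygon.exists_param_of_mem_segment hseg with rfl | ⟨x, h0, h1, rfl⟩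
        · exact Or.inl rfl
        · refine Or.inr ⟨x, Finset.mem_filter.2 ⟨hmemΘ x ((Nat.cast_nonneg _).trans h0) ?_ hp,
            h0, h1⟩, rfl⟩
          have : (((i : ℕ) + 1 : ℕ) : ℝ) ≤ l := by exact_mod_cast i.2
          push_cast at this
          linarith
      · rintro (rfl | ⟨x, hx, rfl⟩)
        · exact ⟨hVS _, right_mem_segment ℝ _ _⟩
        · obtain ⟨hx, h0, h1⟩ := Finset.mem_filter.1 hx
          obtain ⟨q, hq, rfl⟩ := Finset.mem_image.1 hx
          refine ⟨by rw [hf' q hq]; exact hq, ?_⟩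
          rw [segment_eq_image', boundaryPoint_eq V h0 h1.le]
          exact ⟨_, ⟨by linarith, by linarith⟩, rfl⟩
    have hΦl : ∀ x ∈ Φ, 0 ≤ x ∧ x < l := by
      intro x hx
      obtain ⟨q, hq, rfl⟩ := Finset.mem_image.1 (Finset.mem_filter.1 hx).1
      exact hf q hq
    rw [hset, Set.ncard_coe_finset, Finset.card_insert_of_notMem, Finset.card_image_of_injOn] at hc
    · omega
    · exact hP.boundaryPoint_injOn.mono fun x hx => hΦl x hx
    · intro hcon
      obtain ⟨x, hx, hxV⟩ := Finset.mem_image.1 hcon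
      obtain ⟨y, hy0, hy1, hyV, hyn⟩ := hVsucc i i.2
      obtain rfl := hP.boundaryPoint_injOn (hΦl x hx) ⟨hy0, hy1⟩ (hxV.trans hyV.symm)
      exact hyn (Finset.mem_filter.1 hx).2

/-! ### Summation over the sets of used points -/

theorem triangulationPolynomial_eq_sum (S : Finset Plane) :
    triangulationPolynomial S = ∑ T ∈ triangulations S, X ^ (usedPoints T).card := by
  classical
  have hmaps : ∀ T ∈ triangulations S, (usedPoints T).card ∈ Finset.range (S.card + 1) := by
    intro T hT
    rw [mem_triangulations] at hT
    rw [Finset.mem_range, Nat.lt_succ_iff]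
    refine Finset.card_le_card fun p hp => ?_
    obtain ⟨Δ, hΔ, hp⟩ := mem_usedPoints.1 hp
    exact hT.vertices_subset Δ hΔ hp
  rw [triangulationPolynomial, ← Finset.sum_fiberwise_of_maps_to hmaps]
  refine Finset.sum_congr rfl fun k _ => ?_
  rw [Finset.sum_congr rfl (g := fun _ => (X : ℤ[X]) ^ k)
    (fun T hT => by rw [(Finset.mem_filter.1 hT).2]), Finset.sum_const, nsmul_eq_mul, tau]

/-- A triangulation uses all extremal points. -/
theorem IsTriangulation.extr_subset {S : Finset Plane} {T : Finset (Finset Plane)}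
    (h : IsTriangulation S T) : extr S ⊆ usedPoints T := by
  rintro q ⟨hq, hne⟩
  obtain ⟨Δ, hΔ, hqΔ⟩ := h.exists_mem_convexHull (subset_convexHull ℝ _ (Finset.mem_coe.2 hq))
  refine Finset.mem_coe.2 (mem_usedPoints.2 ⟨Δ, hΔ, ?_⟩)
  by_contra hcon
  have hsub : (Δ : Set Plane) ⊆ (S : Set Plane) \ {q} := fun p hp =>
    ⟨h.vertices_subset Δ hΔ hp, fun he => hcon (by rw [Set.mem_singleton_iff] at he; rwa [← he])⟩
  apply hne
  refine Set.Subset.antisymm (convexHull_mono Set.sdiff_subset) (convexHull_min ?_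
    (convex_convexHull ℝ _))
  intro p hp
  by_cases hpq : p = q
  · rw [hpq]; exact convexHull_mono hsub hqΔ
  · exact subset_convexHull ℝ _ ⟨hp, hpq⟩

/-- Triangulations of `S` that use exactly `U` are the full triangulations of `U`. -/
theorem isTriangulation_iff_of_usedPoints {S U : Finset Plane} {T : Finset (Finset Plane)}
    (hUS : U ⊆ S) (hhull : convexHull ℝ (U : Set Plane) = convexHull ℝ (S : Set Plane))
    (hT : usedPoints T = U) : IsTriangulation S T ↔ IsTriangulation U T := by
  constructor
  · intro h
    refine ⟨fun Δ hΔ p hp => ?_, h.card_eq_three, h.nondegenerate, by rw [hhull, h.covers],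
      h.face_to_face⟩
    rw [← hT]
    exact mem_usedPoints.2 ⟨Δ, hΔ, hp⟩
  · intro h
    exact ⟨fun Δ hΔ => (h.vertices_subset Δ hΔ).trans hUS, h.card_eq_three, h.nondegenerate,
      by rw [← hhull, h.covers], h.face_to_face⟩

/-- The complete edge polynomial sums the maximal edge polynomials over the subsets of the points
in the interior of the edge. -/
theorem completeEdgePolynomial_card {α : Type*} (I : Finset α) :
    completeEdgePolynomial (I.card + 1) = ∑ Y ∈ I.powerset,
      (maxEdgePolynomial (Y.card + 1)).map (C : ℤ →+* ℤ[X]) * C (X ^ (Y.card + 1)) := by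
  rw [Finset.sum_powerset_apply_card (fun k => (maxEdgePolynomial (k + 1)).map (C : ℤ →+* ℤ[X]) *
    C (X ^ (k + 1))), completeEdgePolynomial]
  refine (Finset.sum_bij (fun k _ => k + 1) ?_ ?_ ?_ ?_).symm
  · intro k hk
    rw [Finset.mem_range] at hk
    rw [Finset.mem_Icc]
    omega
  · intro k _ k' _ h
    omega
  · intro k hk
    rw [Finset.mem_Icc] at hk
    exact ⟨k - 1, by rw [Finset.mem_range]; omega, by omega⟩
  · intro k hk
    rw [nsmul_eq_mul, Nat.add_sub_cancel, Nat.add_sub_cancel, mul_assoc]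

/-- The number of parameters on a side is one more than the number strictly inside. -/
theorem card_filter_side {Ψ : Finset ℝ} {i : ℕ} (hi : (i : ℝ) ∈ Ψ) :
    (Ψ.filter (fun x => (i : ℝ) ≤ x ∧ x < i + 1)).card =
      (Ψ.filter (fun x => (i : ℝ) < x ∧ x < i + 1)).card + 1 := by
  rw [← Finset.card_insert_of_notMem (a := (i : ℝ))
    (s := Ψ.filter (fun x => (i : ℝ) < x ∧ x < i + 1)) (by simp)]
  congr 1
  ext x
  simp only [Finset.mem_filter, Finset.mem_insert]
  constructor
  · rintro ⟨h1, h2, h3⟩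
    rcases h2.eq_or_lt with h' | h'
    · exact Or.inl h'.symm
    · exact Or.inr ⟨h1, h', h3⟩
  · rintro (rfl | ⟨h1, h2, h3⟩)
    · exact ⟨hi, le_rfl, by linarith⟩
    · exact ⟨h1, h2.le, h3⟩

theorem card_eq_sum_card_filter_side {Ψ : Finset ℝ} {l : ℕ} (hΨ : ∀ x ∈ Ψ, 0 ≤ x ∧ x < l) :
    Ψ.card = ∑ i : Fin l, (Ψ.filter (fun x => ((i : ℕ) : ℝ) ≤ x ∧ x < (i : ℕ) + 1)).card := by
  rw [← Finset.sum_range (fun i : ℕ => (Ψ.filter (fun x => (i : ℝ) ≤ x ∧ x < i + 1)).card),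
    Finset.card_eq_sum_card_fiberwise (f := fun x : ℝ => ⌊x⌋₊) (t := Finset.range l)]
  · refine Finset.sum_congr rfl fun i _ => ?_
    congr 1
    refine Finset.filter_congr fun x hx => ?_
    exact Nat.floor_eq_iff (hΨ x hx).1
  · intro x hx
    have := hΨ x hx
    rw [Finset.mem_coe, Finset.mem_range, Nat.floor_lt this.1]
    exact this.2

/-- Sets of parameters that contain all vertices correspond to families of subsets of the
interiors of the sides. -/
theorem sum_param_subsets {M : Type*} [AddCommMonoid M] {Θ : Finset ℝ} {l : ℕ}
    (hΘ : ∀ x ∈ Θ, 0 ≤ x ∧ x < l) (hint : ∀ i : ℕ, i < l → (i : ℝ) ∈ Θ)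
    (f : (Fin l → Finset ℝ) → M) :
    ∑ Ψ ∈ Θ.powerset.filter (fun Ψ => ∀ i : Fin l, ((i : ℕ) : ℝ) ∈ Ψ),
      f (fun i => Ψ.filter (fun x => ((i : ℕ) : ℝ) < x ∧ x < (i : ℕ) + 1)) =
    ∑ F ∈ Fintype.piFinset (fun i : Fin l =>
      (Θ.filter (fun x => ((i : ℕ) : ℝ) < x ∧ x < (i : ℕ) + 1)).powerset), f F := by
  classical
  -- two open sides that share a point are equal
  have huniq : ∀ (i j : ℕ) (x : ℝ), (i : ℝ) < x → x < i + 1 → (j : ℝ) < x → x < j + 1 → i = j := by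
    intro i j x h1 h2 h3 h4
    have h5 : (i : ℝ) < (j + 1 : ℕ) := by push_cast; linarith
    have h6 : (j : ℝ) < (i + 1 : ℕ) := by push_cast; linarith
    have h5' : i < j + 1 := by exact_mod_cast h5
    have h6' : j < i + 1 := by exact_mod_cast h6
    omega
  have hnat : ∀ (i j : ℕ), ¬ ((i : ℝ) < (j : ℝ) ∧ (j : ℝ) < i + 1) := by
    rintro i j ⟨h1, h2⟩
    have h1' : i < j := by exact_mod_cast h1
    have h2' : j < i + 1 := by exact_mod_cast h2
    omega
  refine Finset.sum_bij'
    (fun Ψ _ => fun i : Fin l => Ψ.filter (fun x => ((i : ℕ) : ℝ) < x ∧ x < (i : ℕ) + 1))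
    (fun F _ => (Finset.univ.image fun i : Fin l => ((i : ℕ) : ℝ)) ∪ Finset.univ.biUnion F)
    ?_ ?_ ?_ ?_ ?_
  · intro Ψ hΨ
    rw [Finset.mem_filter, Finset.mem_powerset] at hΨ
    rw [Fintype.mem_piFinset]
    intro i
    rw [Finset.mem_powerset]
    exact Finset.filter_subset_filter _ hΨ.1
  · intro F hF
    rw [Fintype.mem_piFinset] at hF
    rw [Finset.mem_filter, Finset.mem_powerset]
    refine ⟨Finset.union_subset ?_ ?_, fun i => ?_⟩
    · intro x hx
      obtain ⟨i, -, rfl⟩ := Finset.mem_image.1 hx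
      exact hint i i.2
    · refine Finset.biUnion_subset.2 fun i _ => ?_
      exact (Finset.mem_powerset.1 (hF i)).trans (Finset.filter_subset _ _)
    · exact Finset.mem_union_left _ (Finset.mem_image_of_mem _ (Finset.mem_univ i))
  · intro Ψ hΨ
    rw [Finset.mem_filter, Finset.mem_powerset] at hΨ
    ext x
    simp only [Finset.mem_union, Finset.mem_image, Finset.mem_univ, true_and, Finset.mem_biUnion,
      Finset.mem_filter]
    constructor
    · rintro (⟨i, rfl⟩ | ⟨i, hx, -⟩)
      · exact hΨ.2 i
      · exact hx
    · intro hx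
      have hx' := hΘ x (hΨ.1 hx)
      obtain ⟨i, h0, h1⟩ := exists_floor hx'.1
      have hil : i < l := by exact_mod_cast h0.trans_lt hx'.2
      rcases h0.eq_or_lt with h0 | h0
      · exact Or.inl ⟨⟨i, hil⟩, h0⟩
      · exact Or.inr ⟨⟨i, hil⟩, hx, h0, h1⟩
  · intro F hF
    rw [Fintype.mem_piFinset] at hF
    funext i
    ext x
    simp only [Finset.mem_union, Finset.mem_image, Finset.mem_univ, true_and, Finset.mem_biUnion,
      Finset.mem_filter]
    constructor
    · rintro ⟨⟨j, rfl⟩ | ⟨j, hx⟩, h0, h1⟩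
      · exact absurd ⟨h0, h1⟩ (hnat i j)
      · have hj := (Finset.mem_filter.1 (Finset.mem_powerset.1 (hF j) hx)).2
        obtain rfl : i = j := Fin.ext (huniq i j x h0 h1 hj.1 hj.2)
        exact hx
    · intro hx
      have hi := (Finset.mem_filter.1 (Finset.mem_powerset.1 (hF i) hx)).2
      exact ⟨Or.inr ⟨i, hx⟩, hi⟩
  · intro Ψ _
    rfl

/-- The triangulation polynomial of a parametrized weakly convex polygon, as a sum over the
parameter sets of the used points. -/
theorem IsStrictPolygon.triangulationPolynomial_eq {V : ℕ → Plane} {l : ℕ}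
    (h : IsStrictPolygon V l) {Θ : Finset ℝ} (hΘ : ∀ x ∈ Θ, 0 ≤ x ∧ x < l)
    (hextr : V '' Set.Iio l = extr (Θ.image (boundaryPoint V))) :
    triangulationPolynomial (Θ.image (boundaryPoint V)) =
      ∑ Ψ ∈ Θ.powerset.filter (fun Ψ => ∀ i : Fin l, ((i : ℕ) : ℝ) ∈ Ψ),
        C (catalanPairing ℤ (∏ i : Fin l, maxEdgePolynomial
          (Ψ.filter (fun x => ((i : ℕ) : ℝ) ≤ x ∧ x < (i : ℕ) + 1)).card)) * X ^ Ψ.card := by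
  classical
  set S := Θ.image (boundaryPoint V) with hS
  have hinjΘ : Set.InjOn (boundaryPoint V) Θ := h.boundaryPoint_injOn.mono fun x hx => hΘ x hx
  -- the set of parameters of the used points of a triangulation
  set g : Finset (Finset Plane) → Finset ℝ :=
    fun T => Θ.filter (fun x => boundaryPoint V x ∈ usedPoints T) with hg
  have himage : ∀ T, usedPoints T ⊆ S → (g T).image (boundaryPoint V) = usedPoints T := by
    intro T hT
    ext p
    simp only [hg, Finset.mem_image, Finset.mem_filter]
    constructor
    · rintro ⟨x, ⟨-, hx⟩, rfl⟩
      exact hx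
    · intro hp
      obtain ⟨x, hx, rfl⟩ := Finset.mem_image.1 (hT hp)
      exact ⟨x, ⟨hx, hp⟩, rfl⟩
  have hused : ∀ T, IsTriangulation S T → usedPoints T ⊆ S := by
    intro T hT p hp
    obtain ⟨Δ, hΔ, hp⟩ := mem_usedPoints.1 hp
    exact hT.vertices_subset Δ hΔ hp
  have hmaps : ∀ T ∈ triangulations S,
      g T ∈ Θ.powerset.filter (fun Ψ => ∀ i : Fin l, ((i : ℕ) : ℝ) ∈ Ψ) := by
    intro T hT
    rw [mem_triangulations] at hT
    rw [Finset.mem_filter, Finset.mem_powerset]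
    refine ⟨Finset.filter_subset _ _, fun i => ?_⟩
    have hVi : V i ∈ extr S := by rw [← hextr]; exact ⟨i, i.2, rfl⟩
    have hVi' : V i ∈ usedPoints T := hT.extr_subset hVi
    rw [← himage T (hused T hT)] at hVi'
    obtain ⟨x, hx, hxV⟩ := Finset.mem_image.1 hVi'
    rw [← boundaryPoint_natCast V i] at hxV
    have := h.boundaryPoint_injOn (hΘ x (Finset.mem_filter.1 hx).1)
      (⟨by positivity, by exact_mod_cast i.2⟩ : ((i : ℕ) : ℝ) ∈ Set.Ico (0 : ℝ) l) hxV
    rwa [← this]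
  rw [triangulationPolynomial_eq_sum, ← Finset.sum_fiberwise_of_maps_to hmaps]
  refine Finset.sum_congr rfl fun Ψ hΨ => ?_
  rw [Finset.mem_filter, Finset.mem_powerset] at hΨ
  obtain ⟨hΨΘ, hΨint⟩ := hΨ
  have hΨl : ∀ x ∈ Ψ, 0 ≤ x ∧ x < l := fun x hx => hΘ x (hΨΘ hx)
  set U := Ψ.image (boundaryPoint V) with hU
  have hUS : U ⊆ S := Finset.image_subset_image hΨΘ
  have hUcard : U.card = Ψ.card := Finset.card_image_of_injOn (hinjΘ.mono hΨΘ)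
  have hhull : convexHull ℝ (U : Set Plane) = convexHull ℝ (S : Set Plane) := by
    refine Set.Subset.antisymm (convexHull_mono (Finset.coe_subset.2 hUS)) ?_
    rw [← convexHull_extr, ← hextr]
    refine convexHull_mono ?_
    rintro _ ⟨i, hi, rfl⟩
    rw [Finset.mem_coe, hU, Finset.mem_image]
    exact ⟨i, hΨint ⟨i, hi⟩, boundaryPoint_natCast V i⟩
  have hfib : (triangulations S).filter (fun T => g T = Ψ) =
      (triangulations U).filter (fun T => usedPoints T = U) := by
    ext T
    simp only [Finset.mem_filter, mem_triangulations]
    constructor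
    · rintro ⟨hT, hgT⟩
      have hTU : usedPoints T = U := by rw [← himage T (hused T hT), hgT]
      exact ⟨(isTriangulation_iff_of_usedPoints hUS hhull hTU).1 hT, hTU⟩
    · rintro ⟨hT, hTU⟩
      have hT' := (isTriangulation_iff_of_usedPoints hUS hhull hTU).2 hT
      refine ⟨hT', ?_⟩
      have h1 := himage T (hused T hT')
      rw [hTU, hU] at h1
      exact Finset.image_injOn_powerset_of_injOn hinjΘ
        (Finset.mem_coe.2 (Finset.mem_powerset.2 (Finset.filter_subset _ _)))
        (Finset.mem_coe.2 (Finset.mem_powerset.2 hΨΘ)) h1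
  rw [hfib, Finset.sum_congr rfl (g := fun _ => (X : ℤ[X]) ^ Ψ.card)
    (fun T hT => by rw [(Finset.mem_filter.1 hT).2, hUcard]), Finset.sum_const, nsmul_eq_mul]
  congr 1
  have := h.card_full Ψ hΨl (fun i hi => hΨint ⟨i, hi⟩)
  rw [Finset.prod_range] at this
  rw [← this]
  simp only [← hU]
  rw [map_natCast]

theorem catalanPairing_prod_completeEdgePolynomial {l : ℕ} (I : Fin l → Finset ℝ) :
    catalanPairing ℤ[X] (∏ i, completeEdgePolynomial ((I i).card + 1)) =
      ∑ F ∈ Fintype.piFinset (fun i => (I i).powerset),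
        C (catalanPairing ℤ (∏ i, maxEdgePolynomial ((F i).card + 1))) *
          X ^ (∑ i, ((F i).card + 1)) := by
  simp only [completeEdgePolynomial_card]
  rw [Finset.prod_univ_sum, map_sum]
  refine Finset.sum_congr rfl fun F _ => ?_
  rw [Finset.prod_mul_distrib, ← Polynomial.map_prod, ← map_prod, Finset.prod_pow_eq_pow_sum,
    mul_comm, ← smul_eq_C_mul, map_smul, catalanPairing_map, smul_eq_mul, mul_comm]

theorem IsWeaklyConvexPolygon.triangulationPolynomial_eq {l : ℕ} (hl : 3 ≤ l) {a : Fin l → ℕ}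
    {S : Finset Plane} (hS : IsWeaklyConvexPolygon a S) :
    triangulationPolynomial S =
      pairing (∏ i, completeEdgePolynomial (a i))
        (PowerSeries.X ^ 2 * catalanGenerating (Polynomial ℤ)) := by
  obtain ⟨V, Θ, hP, hΘ, hint, rfl, hextr, hcard⟩ := hS.exists_param hl
  have hside : ∀ i : Fin l, a i =
      (Θ.filter (fun x => ((i : ℕ) : ℝ) < x ∧ x < (i : ℕ) + 1)).card + 1 := fun i => by
    rw [← hcard i, card_filter_side (hint i i.2)]
  rw [← catalanPairing_apply, Finset.prod_congr rfl (fun i _ => by rw [hside i]),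
    catalanPairing_prod_completeEdgePolynomial, hP.triangulationPolynomial_eq hΘ hextr,
    ← sum_param_subsets hΘ hint]
  refine Finset.sum_congr rfl fun Ψ hΨ => ?_
  rw [Finset.mem_filter, Finset.mem_powerset] at hΨ
  rw [card_eq_sum_card_filter_side (fun x hx => hΘ x (hΨ.1 hx)),
    Finset.sum_congr rfl (fun i _ => card_filter_side (hΨ.2 i)),
    Finset.prod_congr rfl (fun i _ => by rw [card_filter_side (hΨ.2 i)])]

end WeaklyConvex

theorem mainTheorem3 (l : ℕ) (hl : 3 ≤ l) (a : Fin l → ℕ) (ha : ∀ i, 1 ≤ a i)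
    (S : Finset WeaklyConvex.Plane) (hS : WeaklyConvex.IsWeaklyConvexPolygon a S) :
    WeaklyConvex.triangulationPolynomial S =
      WeaklyConvex.pairing (∏ i, WeaklyConvex.completeEdgePolynomial (a i))
        (PowerSeries.X ^ 2 * WeaklyConvex.catalanGenerating (Polynomial ℤ)) :=
  hS.triangulationPolynomial_eq hl
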